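/- Let $X$ and $S$ be real analytic manifolds (finite-dimensional, Hausdorff, with countable topology). Let $\mathrm{op}(X_{sa})$ be the family of open subanalytic subsets of $X$; a family $\{U_i\}$ of elements of $\mathrm{op}(X_{sa})$ contained in $U\in \mathrm{op}(X_{sa})$ is a covering of $U$ in $X_{sa}$ if for every compact $K\subset X$ there are finitely many indices $i_1,\dots,i_r$ with $K\cap\bigcup_k U_{i_k}=K\cap U$. Let $X_{sa}\times S$ be the site whose objects are the finite unions of products $U\times V$ with $U\in\mathrm{op}(X_{sa})$ and $V\subset S$ open, ordered by inclusion, with the Grothendieck topology generated by the following coverings: a family $T$ of objects contained in $W$ covers $W$ if for every such product $U\times V\subset W$ the family $\{W'\cap(U\times V)\}_{W'\in T}$ admits a refinement $\{U_i\times V_j\}_{i,j}$ with $\{U_i\}$ a covering of $U$ in $X_{sa}$ and $\{V_j\}$ an open covering of $V$. Let $\mathcal T$ be the family of products $U\times V$ with $U\subset X$ and $V\subset S$ open, subanalytic and relatively compact. Let $X_{sa}\times S_{sa}$ be the site whose objects are the locally finite unions of elements of $\mathcal T$, in which $T$ covers $W$ if for every $R\in\mathcal T$ with $R\subset W$ the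 family $\{W'\cap R\}_{W'\in T}$ admits a finite subcover of $R$. For each of the sites $\mathcal S = X\times S$ (usual topology), $X_{sa}\times S$ and $X_{sa}\times S_{sa}$, let $\mathrm{Mod}(\mathbb C_{\mathcal S})$ be the category of sheaves of $\mathbb C$-vector spaces on $\mathcal S$. Let $\rho_S: X\times S\to X_{sa}\times S$ and $\rho':X\times S\to X_{sa}\times S_{sa}$ be the morphisms of sites given by the inclusions of the families of open sets, with inverse image functors $\rho_S^{-1}$ and $\rho'^{-1}$, and let $a: X_{sa}\times S\to X_{sa}\times S_{sa}$ be the morphism of sites given on the basis $\mathcal T$ of $X_{sa}\times S_{sa}$ by inclusion: $a^{-1}G$ is the inverse image of $G|_{\mathcal T}$ along the inclusion of $\mathcal T$ in the objects of $X_{sa}\times S$, where $\mathcal T$ carries the topology in which coverings are the families admitting a finite subcover. Then $\rho'^{-1}$ has a left adjoint $\rho'_!$, and the functor $$\rho_{S!}:=a^{-1}\circ\rho'_!:\ \mathrm{Mod}(\mathbb C_{X\times S})\to\mathrm{Mod}(\mathbb C_{X_{sa}\times S})$$ is left adjoint to $\rho_S^{-1}$. The functor $\rho_{S!}$ is exact,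 and it commutes with tensor products: there is an isomorphism $\rho_{S!}(A\otimes B)\simeq\rho_{S!}A\otimes\rho_{S!}B$, natural in $A,B\in\mathrm{Mod}(\mathbb C_{X\times S})$, for which the composite $$A\otimes B\to\rho_S^{-1}\rho_{S!}(A\otimes B)\simeq\rho_S^{-1}(\rho_{S!}A\otimes\rho_{S!}B)\to\rho_S^{-1}\rho_{S!}A\otimes\rho_S^{-1}\rho_{S!}B$$ of the adjunction unit, the image of the isomorphism and the canonical morphism is the tensor product of the adjunction units of $A$ and $B$. -/

import Mathlib

open CategoryTheory TopologicalSpace MonoidalCategory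
open scoped Manifold ContDiff

attribute [local instance] CategoryTheory.Sheaf.monoidalCategory

noncomputable section

namespace RelSubanalytic

/-! ### Semianalytic and subanalytic sets -/

section Subanalytic

variable {E H : Type*} [NormedAddCommGroup E] [NormedSpace ℝ E] [TopologicalSpace H]
  (I : ModelWithCorners ℝ E H) {M : Type*} [TopologicalSpace M] [ChartedSpace H M]

/-- `A ⊆ M` is semianalytic: every point of `M` has an open neighbourhood `U` on which `A` is a
finite union of sets, each of them given by finitely many equations `f = 0` and strict
inequalities `g > 0` between real analytic functions on `U`. -/
def IsSemianalytic (A : Set M) : Prop :=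
  ∀ x : M, ∃ U : Set M, IsOpen U ∧ x ∈ U ∧
    ∃ (ι κ : Type) (_ : Finite ι) (_ : Finite κ) (f g : ι → κ → M → ℝ),
      (∀ i j, ContMDiffOn I 𝓘(ℝ, ℝ) ω (f i j) U ∧ ContMDiffOn I 𝓘(ℝ, ℝ) ω (g i j) U) ∧
      A ∩ U = {y | y ∈ U ∧ ∃ i, ∀ j, f i j y = 0 ∧ 0 < g i j y}

/-- `A ⊆ M` is subanalytic: every point of `M` has an open neighbourhood `U` such that `A ∩ U` is
the projection to `M` of a relatively compact semianalytic subset of `M × V`, for some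
finite-dimensional real vector space `V`. -/
def IsSubanalytic (A : Set M) : Prop :=
  ∀ x : M, ∃ U : Set M, IsOpen U ∧ x ∈ U ∧
    ∃ (V : Type) (_ : NormedAddCommGroup V) (_ : NormedSpace ℝ V) (_ : FiniteDimensional ℝ V)
      (B : Set (M × V)),
      IsSemianalytic (I.prod 𝓘(ℝ, V)) B ∧ IsCompact (closure B) ∧ A ∩ U = Prod.fst '' B

variable {I}

theorem IsSemianalytic.inter {A B : Set M} (hA : IsSemianalytic I A) (hB : IsSemianalytic I B) :
    IsSemianalytic I (A ∩ B) := by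
  intro x
  obtain ⟨U, hU, hxU, ι, κ, _, _, f, g, hfg, hAU⟩ := hA x
  obtain ⟨U', hU', hxU', ι', κ', _, _, f', g', hfg', hBU⟩ := hB x
  refine ⟨U ∩ U', hU.inter hU', ⟨hxU, hxU'⟩, ι × ι', κ ⊕ κ', inferInstance, inferInstance,
    fun i => Sum.elim (f i.1) (f' i.2), fun i => Sum.elim (g i.1) (g' i.2), ?_, ?_⟩
  · rintro ⟨i, i'⟩ (j | j)
    · exact ⟨(hfg i j).1.mono Set.inter_subset_left, (hfg i j).2.mono Set.inter_subset_left⟩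
    · exact ⟨(hfg' i' j).1.mono Set.inter_subset_right, (hfg' i' j).2.mono Set.inter_subset_right⟩
  · ext y
    have h1 := Set.ext_iff.1 hAU y
    have h2 := Set.ext_iff.1 hBU y
    simp only [Set.mem_inter_iff, Set.mem_ofPred_eq] at h1 h2
    simp only [Set.mem_inter_iff, Set.mem_ofPred_eq, Prod.exists, Sum.forall, Sum.elim_inl,
      Sum.elim_inr]
    constructor
    · rintro ⟨⟨hyA, hyB⟩, hy, hy'⟩
      obtain ⟨-, i, hi⟩ := h1.1 ⟨hyA, hy⟩
      obtain ⟨-, i', hi'⟩ := h2.1 ⟨hyB, hy'⟩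
      exact ⟨⟨hy, hy'⟩, i, i', hi, hi'⟩
    · rintro ⟨⟨hy, hy'⟩, i, i', hi, hi'⟩
      exact ⟨⟨(h1.2 ⟨hy, i, hi⟩).1, (h2.2 ⟨hy', i', hi'⟩).1⟩, hy, hy'⟩

theorem IsSemianalytic.preimage {E' H' M' : Type*} [NormedAddCommGroup E'] [NormedSpace ℝ E']
    [TopologicalSpace H'] {I' : ModelWithCorners ℝ E' H'} [TopologicalSpace M']
    [ChartedSpace H' M'] {φ : M' → M} (hφ : ContMDiff I' I ω φ) {A : Set M}
    (hA : IsSemianalytic I A) : IsSemianalytic I' (φ ⁻¹' A) := by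
  intro x
  obtain ⟨U, hU, hxU, ι, κ, _, _, f, g, hfg, hAU⟩ := hA (φ x)
  refine ⟨φ ⁻¹' U, hU.preimage hφ.continuous, hxU, ι, κ, inferInstance, inferInstance,
    fun i j => f i j ∘ φ, fun i j => g i j ∘ φ, fun i j => ⟨?_, ?_⟩, ?_⟩
  · exact (hfg i j).1.comp hφ.contMDiffOn subset_rfl
  · exact (hfg i j).2.comp hφ.contMDiffOn subset_rfl
  · rw [← Set.preimage_inter, hAU]
    rfl

/-- The intersection of two subanalytic sets is subanalytic (by fibre products over `M`). -/
theorem IsSubanalytic.inter [T2Space M] {A A' : Set M} (hA : IsSubanalytic I A)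
    (hA' : IsSubanalytic I A') : IsSubanalytic I (A ∩ A') := by
  intro x
  obtain ⟨U, hU, hxU, V, _, _, _, B, hB, hBc, hAU⟩ := hA x
  obtain ⟨U', hU', hxU', V', _, _, _, B', hB', hBc', hAU'⟩ := hA' x
  let p : M × (V × V') → M × V := fun z => (z.1, z.2.1)
  let p' : M × (V × V') → M × V' := fun z => (z.1, z.2.2)
  have hp : ContMDiff (I.prod 𝓘(ℝ, V × V')) (I.prod 𝓘(ℝ, V)) ω p :=
    contMDiff_fst.prodMk ((ContinuousLinearMap.fst ℝ V V').contMDiff.comp contMDiff_snd)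
  have hp' : ContMDiff (I.prod 𝓘(ℝ, V × V')) (I.prod 𝓘(ℝ, V')) ω p' :=
    contMDiff_fst.prodMk ((ContinuousLinearMap.snd ℝ V V').contMDiff.comp contMDiff_snd)
  refine ⟨U ∩ U', hU.inter hU', ⟨hxU, hxU'⟩, V × V', inferInstance, inferInstance, inferInstance,
    p ⁻¹' B ∩ p' ⁻¹' B', (hB.preimage hp).inter (hB'.preimage hp'), ?_, ?_⟩
  · have hK : IsCompact ((Prod.fst '' closure B) ×ˢ
        ((Prod.snd '' closure B) ×ˢ (Prod.snd '' closure B'))) :=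
      (hBc.image continuous_fst).prod ((hBc.image continuous_snd).prod (hBc'.image continuous_snd))
    refine hK.closure_of_subset ?_
    rintro ⟨m, v, v'⟩ ⟨h1, h2⟩
    exact ⟨⟨(m, v), subset_closure h1, rfl⟩, ⟨(m, v), subset_closure h1, rfl⟩,
      ⟨(m, v'), subset_closure h2, rfl⟩⟩
  · ext y
    have h1 := Set.ext_iff.1 hAU y
    have h2 := Set.ext_iff.1 hAU' y
    simp only [Set.mem_inter_iff, Set.mem_image, Prod.exists, exists_and_right,
      exists_eq_right] at h1 h2
    simp only [Set.mem_inter_iff, Set.mem_image, Prod.exists, Set.mem_preimage, p, p']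
    constructor
    · rintro ⟨⟨hyA, hyA'⟩, hy, hy'⟩
      obtain ⟨v, hv⟩ := h1.1 ⟨hyA, hy⟩
      obtain ⟨v', hv'⟩ := h2.1 ⟨hyA', hy'⟩
      exact ⟨y, v, v', ⟨hv, hv'⟩, rfl⟩
    · rintro ⟨_, v, v', ⟨hv, hv'⟩, rfl⟩
      exact ⟨⟨(h1.2 ⟨v, hv⟩).1, (h2.2 ⟨v', hv'⟩).1⟩, (h1.2 ⟨v, hv⟩).2, (h2.2 ⟨v', hv'⟩).2⟩

end Subanalytic

/-! ### The families of open subsets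

`X` and `S` are real analytic manifolds modelled on `E` and `F`. -/

section Opens

/-- `U` is an object of `op(X_sa)`: an open subanalytic subset of the manifold `X`. -/
def IsSaOpen (E : Type) [NormedAddCommGroup E] [NormedSpace ℝ E] {X : Type} [TopologicalSpace X]
    [ChartedSpace E X] (U : Set X) : Prop :=
  IsOpen U ∧ IsSubanalytic 𝓘(ℝ, E) U

/-- `𝒰` is a covering of `U` in the subanalytic site `X_sa`. -/
def IsSaCover (E : Type) [NormedAddCommGroup E] [NormedSpace ℝ E] {X : Type} [TopologicalSpace X]
    [ChartedSpace E X] (U : Set X) (𝒰 : Set (Set X)) : Prop :=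
  (∀ U' ∈ 𝒰, IsSaOpen E U' ∧ U' ⊆ U) ∧
    ∀ K : Set X, IsCompact K → ∃ 𝒰₀ ⊆ 𝒰, 𝒰₀.Finite ∧ K ∩ ⋃₀ 𝒰₀ = K ∩ U

/-- `𝒱` is an open covering of `V` in the usual topology of `S`. -/
def IsOpenCover {S : Type} [TopologicalSpace S] (V : Set S) (𝒱 : Set (Set S)) : Prop :=
  (∀ V' ∈ 𝒱, IsOpen V') ∧ ⋃₀ 𝒱 = V

theorem IsSaOpen.inter {E : Type} [NormedAddCommGroup E] [NormedSpace ℝ E] {X : Type}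
    [TopologicalSpace X] [ChartedSpace E X] [T2Space X] {U U' : Set X} (h : IsSaOpen E U)
    (h' : IsSaOpen E U') : IsSaOpen E (U ∩ U') :=
  ⟨h.1.inter h'.1, h.2.inter h'.2⟩

variable (E F : Type) [NormedAddCommGroup E] [NormedSpace ℝ E] [NormedAddCommGroup F]
  [NormedSpace ℝ F] {X S : Type} [TopologicalSpace X] [ChartedSpace E X]
  [TopologicalSpace S] [ChartedSpace F S]

/-- `R` belongs to the family `𝒯` of products `U × V` with `U` and `V` relatively compact
subanalytic open subsets of `X` and of `S`. -/
def IsBox (R : Set (X × S)) : Prop :=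
  ∃ (U : Set X) (V : Set S), (IsSaOpen E U ∧ IsCompact (closure U)) ∧
    (IsSaOpen F V ∧ IsCompact (closure V)) ∧ R = U ×ˢ V

/-- `W` is an object of `op(X_sa × S_sa)`: a locally finite union of elements of `𝒯`. -/
def IsBiSaOpen (W : Set (X × S)) : Prop :=
  ∃ 𝓑 : Set (Set (X × S)), (∀ R ∈ 𝓑, IsBox E F R) ∧ LocallyFinite (fun R : 𝓑 => (R : Set (X × S))) ∧
    W = ⋃₀ 𝓑

/-- `W` is an object of `op(X_sa × S)`: a finite union of products `U × V` with `U` open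
subanalytic in `X` and `V` open in `S`. -/
def IsRelOpen (W : Set (X × S)) : Prop :=
  ∃ 𝓟 : Set (Set (X × S)), 𝓟.Finite ∧
    (∀ P ∈ 𝓟, ∃ (U : Set X) (V : Set S), IsSaOpen E U ∧ IsOpen V ∧ P = U ×ˢ V) ∧ W = ⋃₀ 𝓟

variable {E F}

theorem IsBox.inter [T2Space X] [T2Space S] {R R' : Set (X × S)} (h : IsBox E F R)
    (h' : IsBox E F R') : IsBox E F (R ∩ R') := by
  obtain ⟨U, V, ⟨hU, hUc⟩, ⟨hV, hVc⟩, rfl⟩ := h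
  obtain ⟨U', V', ⟨hU', -⟩, ⟨hV', -⟩, rfl⟩ := h'
  exact ⟨U ∩ U', V ∩ V',
    ⟨hU.inter hU', hUc.of_isClosed_subset isClosed_closure (closure_mono Set.inter_subset_left)⟩,
    ⟨hV.inter hV', hVc.of_isClosed_subset isClosed_closure (closure_mono Set.inter_subset_left)⟩,
    Set.prod_inter_prod⟩

theorem IsBox.isOpen {R : Set (X × S)} (h : IsBox E F R) : IsOpen R := by
  obtain ⟨U, V, ⟨hU, -⟩, ⟨hV, -⟩, rfl⟩ := h
  exact hU.1.prod hV.1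

theorem IsBox.isCompact_closure {R : Set (X × S)} (h : IsBox E F R) : IsCompact (closure R) := by
  obtain ⟨U, V, ⟨-, hU⟩, ⟨-, hV⟩, rfl⟩ := h
  rw [closure_prod_eq]
  exact hU.prod hV

theorem IsBox.isBiSaOpen {R : Set (X × S)} (h : IsBox E F R) : IsBiSaOpen E F R :=
  ⟨{R}, by simpa using h, locallyFinite_of_finite _, by simp⟩

theorem IsBox.isRelOpen {R : Set (X × S)} (h : IsBox E F R) : IsRelOpen E R := by
  obtain ⟨U, V, ⟨hU, -⟩, ⟨hV, -⟩, rfl⟩ := h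
  exact ⟨{U ×ˢ V}, Set.finite_singleton _, by rintro _ rfl; exact ⟨U, V, hU, hV.1, rfl⟩, by simp⟩

theorem IsBiSaOpen.inter [T2Space X] [T2Space S] {W W' : Set (X × S)} (h : IsBiSaOpen E F W)
    (h' : IsBiSaOpen E F W') : IsBiSaOpen E F (W ∩ W') := by
  obtain ⟨𝓑, h𝓑, hf, rfl⟩ := h
  obtain ⟨𝓑', h𝓑', hf', rfl⟩ := h'
  refine ⟨Set.image2 (· ∩ ·) 𝓑 𝓑', ?_, ?_, ?_⟩
  · rintro _ ⟨R, hR, R', hR', rfl⟩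
    exact (h𝓑 R hR).inter (h𝓑' R' hR')
  · intro z
    obtain ⟨t, ht, hfin⟩ := hf z
    obtain ⟨t', ht', hfin'⟩ := hf' z
    refine ⟨t ∩ t', Filter.inter_mem ht ht', ?_⟩
    refine Set.Finite.of_finite_image (f := Subtype.val) ?_ Subtype.val_injective.injOn
    refine ((hfin.image Subtype.val).image2 (· ∩ ·) (hfin'.image Subtype.val)).subset ?_
    rintro _ ⟨⟨_, R, hR, R', hR', rfl⟩, ⟨y, ⟨hyR, hyR'⟩, hyt, hyt'⟩, rfl⟩
    exact ⟨R, ⟨⟨R, hR⟩, ⟨y, hyR, hyt⟩, rfl⟩, R', ⟨⟨R', hR'⟩, ⟨y, hyR', hyt'⟩, rfl⟩, rfl⟩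
  · rw [Set.sUnion_inter_sUnion]
    ext y
    simp only [Set.mem_iUnion, Set.mem_sUnion, Set.mem_image2]
    aesop

theorem IsRelOpen.inter [T2Space X] {W W' : Set (X × S)} (h : IsRelOpen E W)
    (h' : IsRelOpen E W') : IsRelOpen E (W ∩ W') := by
  obtain ⟨𝓟, hf, h𝓟, rfl⟩ := h
  obtain ⟨𝓟', hf', h𝓟', rfl⟩ := h'
  refine ⟨Set.image2 (· ∩ ·) 𝓟 𝓟', hf.image2 _ hf', ?_, ?_⟩
  · rintro _ ⟨P, hP, P', hP', rfl⟩
    obtain ⟨U, V, hU, hV, rfl⟩ := h𝓟 P hP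
    obtain ⟨U', V', hU', hV', rfl⟩ := h𝓟' P' hP'
    exact ⟨U ∩ U', V ∩ V', hU.inter hU', hV.inter hV', Set.prod_inter_prod⟩
  · rw [Set.sUnion_inter_sUnion]
    ext y
    simp only [Set.mem_iUnion, Set.mem_sUnion, Set.mem_image2]
    aesop

/-- An element of `op(X_sa × S_sa)` is, inside an element of `𝒯`, a finite union of elements
of `𝒯`. -/
theorem IsBiSaOpen.finite_boxes [T2Space X] [T2Space S] {W R : Set (X × S)}
    (hW : IsBiSaOpen E F W) (hR : IsBox E F R) :
    ∃ 𝓑 : Set (Set (X × S)), 𝓑.Finite ∧ (∀ R' ∈ 𝓑, IsBox E F R' ∧ R' ⊆ W ∧ R' ⊆ R) ∧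
      W ∩ R ⊆ ⋃₀ 𝓑 := by
  obtain ⟨𝓑, h𝓑, hf, rfl⟩ := hW
  refine ⟨(fun R' : 𝓑 => (R' : Set (X × S)) ∩ R) ''
    {R' : 𝓑 | ((R' : Set (X × S)) ∩ closure R).Nonempty},
    (hf.finite_nonempty_inter_compact hR.isCompact_closure).image _, ?_, ?_⟩
  · rintro _ ⟨R', -, rfl⟩
    exact ⟨(h𝓑 _ R'.2).inter hR,
      Set.inter_subset_left.trans (Set.subset_sUnion_of_mem R'.2), Set.inter_subset_right⟩
  · rintro y ⟨⟨R', hR', hy⟩, hyR⟩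
    exact ⟨R' ∩ R, ⟨⟨R', hR'⟩, ⟨y, hy, subset_closure hyR⟩, rfl⟩, hy, hyR⟩

end Opens

/-! ### The sites -/

section Sites

variable (E F X S : Type) [NormedAddCommGroup E] [NormedSpace ℝ E] [NormedAddCommGroup F]
  [NormedSpace ℝ F] [TopologicalSpace X] [ChartedSpace E X] [TopologicalSpace S] [ChartedSpace F S]

/-- The family `𝒯`, ordered by inclusion and regarded as a category. -/
abbrev Box : Type := {W : Opens (X × S) // IsBox E F (W : Set (X × S))}

/-- The category `op(X_sa × S_sa)`. -/
abbrev BiSaOpen : Type := {W : Opens (X × S) // IsBiSaOpen E F (W : Set (X × S))}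

/-- The category `op(X_sa × S)`. -/
abbrev RelOpen : Type := {W : Opens (X × S) // IsRelOpen E (W : Set (X × S))}

variable [T2Space X] [T2Space S]

/-- The topology of `X_sa × S_sa` restricted to `𝒯`: the coverings of `R ∈ 𝒯` are those which
admit a finite subcover. -/
def boxTopology : GrothendieckTopology (Box E F X S) where
  sieves R := {T | ∃ Φ : Set (Box E F X S), Φ.Finite ∧ (∀ R' ∈ Φ, ∃ f : R' ⟶ R, T f) ∧
    (R.1 : Set (X × S)) ⊆ ⋃ R' ∈ Φ, (R'.1 : Set (X × S))}
  top_mem' R := ⟨{R}, Set.finite_singleton R, by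
    rintro _ rfl
    exact ⟨𝟙 _, trivial⟩, by simp⟩
  pullback_stable' := by
    rintro R R' T f ⟨Φ, hΦ, hT, hR⟩
    refine ⟨(fun Q : Box E F X S => ⟨Q.1 ⊓ R'.1, Q.2.inter R'.2⟩) '' Φ, hΦ.image _, ?_, ?_⟩
    · rintro _ ⟨Q, hQ, rfl⟩
      obtain ⟨g, hg⟩ := hT Q hQ
      exact ⟨homOfLE (inf_le_right : Q.1 ⊓ R'.1 ≤ R'.1),
        T.downward_closed hg (homOfLE (inf_le_left : Q.1 ⊓ R'.1 ≤ Q.1))⟩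
    · intro y hy
      obtain ⟨Q, hQ, hyQ⟩ := Set.mem_iUnion₂.1 (hR (leOfHom f hy))
      exact Set.mem_iUnion₂.2 ⟨_, ⟨Q, hQ, rfl⟩, hyQ, hy⟩
  transitive' := by
    rintro R T ⟨Φ, hΦ, hT, hR⟩ T' h
    have h' : ∀ Q : Φ, ∃ Ψ : Set (Box E F X S), Ψ.Finite ∧ (∀ R' ∈ Ψ, ∃ f : R' ⟶ R, T' f) ∧
        (Q.1.1 : Set (X × S)) ⊆ ⋃ R' ∈ Ψ, (R'.1 : Set (X × S)) := by
      rintro ⟨Q, hQ⟩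
      obtain ⟨g, hg⟩ := hT Q hQ
      obtain ⟨Ψ, hΨ, h1, h2⟩ := h hg
      exact ⟨Ψ, hΨ, fun R' hR' => (h1 R' hR').elim fun f hf => ⟨f ≫ g, hf⟩, h2⟩
    choose Ψ hΨ h1 h2 using h'
    have := hΦ.to_subtype
    refine ⟨⋃ Q, Ψ Q, Set.finite_iUnion hΨ, ?_, ?_⟩
    · intro R' hR'
      obtain ⟨Q, hQ⟩ := Set.mem_iUnion.1 hR'
      exact h1 Q R' hQ
    · intro y hy
      obtain ⟨Q, hQ, hyQ⟩ := Set.mem_iUnion₂.1 (hR hy)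
      obtain ⟨R', hR', hyR'⟩ := Set.mem_iUnion₂.1 (h2 ⟨Q, hQ⟩ hyQ)
      exact Set.mem_iUnion₂.2 ⟨R', Set.mem_iUnion.2 ⟨_, hR'⟩, hyR'⟩

/-- The topology of the site `X_sa × S_sa`: `T` is a covering of `W` if for every `R ∈ 𝒯` with
`R ⊆ W` the family of the `W' ∩ R`, `W' ∈ T`, admits a finite subcover of `R`. -/
def biSaTopology : GrothendieckTopology (BiSaOpen E F X S) where
  sieves W := {T | ∀ R : Box E F X S, R.1 ≤ W.1 →
    ∃ Φ : Set (BiSaOpen E F X S), Φ.Finite ∧ (∀ W' ∈ Φ, ∃ f : W' ⟶ W, T f) ∧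
      (R.1 : Set (X × S)) ⊆ ⋃ W' ∈ Φ, (W'.1 : Set (X × S))}
  top_mem' W := fun R hR => ⟨{W}, Set.finite_singleton W, by
    rintro _ rfl
    exact ⟨𝟙 _, trivial⟩, by simpa using hR⟩
  pullback_stable' := by
    intro W W' T f h R hRW'
    obtain ⟨Φ, hΦ, hT, hR⟩ := h R (hRW'.trans (leOfHom f))
    refine ⟨(fun Q : BiSaOpen E F X S => ⟨Q.1 ⊓ W'.1, Q.2.inter W'.2⟩) '' Φ, hΦ.image _, ?_, ?_⟩
    · rintro _ ⟨Q, hQ, rfl⟩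
      obtain ⟨g, hg⟩ := hT Q hQ
      exact ⟨homOfLE (inf_le_right : Q.1 ⊓ W'.1 ≤ W'.1),
        T.downward_closed hg (homOfLE (inf_le_left : Q.1 ⊓ W'.1 ≤ Q.1))⟩
    · intro y hy
      obtain ⟨Q, hQ, hyQ⟩ := Set.mem_iUnion₂.1 (hR hy)
      exact Set.mem_iUnion₂.2 ⟨_, ⟨Q, hQ, rfl⟩, hyQ, hRW' hy⟩
  transitive' := by
    intro W T hT' T' h R hRW
    obtain ⟨Φ, hΦ, hT, hR⟩ := hT' R hRW
    have h' : ∀ Q : Φ, ∃ Ψ : Set (BiSaOpen E F X S), Ψ.Finite ∧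
        (∀ W' ∈ Ψ, ∃ f : W' ⟶ W, T' f) ∧
        (Q.1.1 : Set (X × S)) ∩ R.1 ⊆ ⋃ W' ∈ Ψ, (W'.1 : Set (X × S)) := by
      rintro ⟨Q, hQ⟩
      obtain ⟨g, hg⟩ := hT Q hQ
      obtain ⟨𝓑, hfin, hbox, hcov⟩ := Q.2.finite_boxes R.2
      have h'' : ∀ P : 𝓑, ∃ Ψ : Set (BiSaOpen E F X S), Ψ.Finite ∧
          (∀ W' ∈ Ψ, ∃ f : W' ⟶ W, T' f) ∧
          (P : Set (X × S)) ⊆ ⋃ W' ∈ Ψ, (W'.1 : Set (X × S)) := by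
        rintro ⟨P, hP⟩
        obtain ⟨Ψ, hΨ, h1, h2⟩ := h hg ⟨⟨P, (hbox P hP).1.isOpen⟩, (hbox P hP).1⟩ (hbox P hP).2.1
        exact ⟨Ψ, hΨ, fun W' hW' => (h1 W' hW').elim fun f hf => ⟨f ≫ g, hf⟩, h2⟩
      choose Ψ hΨ h1 h2 using h''
      have := hfin.to_subtype
      refine ⟨⋃ P, Ψ P, Set.finite_iUnion hΨ, ?_, ?_⟩
      · intro W' hW'
        obtain ⟨P, hP⟩ := Set.mem_iUnion.1 hW'
        exact h1 P W' hP
      · intro y hy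
        obtain ⟨P, hP, hyP⟩ := hcov hy
        obtain ⟨W', hW', hyW'⟩ := Set.mem_iUnion₂.1 (h2 ⟨P, hP⟩ hyP)
        exact Set.mem_iUnion₂.2 ⟨W', Set.mem_iUnion.2 ⟨_, hW'⟩, hyW'⟩
    choose Ψ hΨ h1 h2 using h'
    have := hΦ.to_subtype
    refine ⟨⋃ Q, Ψ Q, Set.finite_iUnion hΨ, ?_, ?_⟩
    · intro W' hW'
      obtain ⟨Q, hQ⟩ := Set.mem_iUnion.1 hW'
      exact h1 Q W' hQ
    · intro y hy
      obtain ⟨Q, hQ, hyQ⟩ := Set.mem_iUnion₂.1 (hR hy)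
      obtain ⟨W', hW', hyW'⟩ := Set.mem_iUnion₂.1 (h2 ⟨Q, hQ⟩ ⟨hyQ, hy⟩)
      exact Set.mem_iUnion₂.2 ⟨W', Set.mem_iUnion.2 ⟨_, hW'⟩, hyW'⟩

variable {E S} in
/-- The presieve `T` on `W` is a covering of `W` in `X_sa × S`: for every product `U × V ⊆ W` with
`U` in `op(X_sa)` and `V` open in `S`, the restriction of `T` to `U × V` admits a refinement
`{U_i × V_j}` with `{U_i}` a covering of `U` in `X_sa` and `{V_j}` an open covering of `V`. -/
def IsRelCover (W : RelOpen E X S) (T : Presieve W) : Prop :=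
  ∀ (U : Set X) (V : Set S), IsSaOpen E U → IsOpen V → U ×ˢ V ⊆ (W.1 : Set (X × S)) →
    ∃ (𝒰 : Set (Set X)) (𝒱 : Set (Set S)), IsSaCover E U 𝒰 ∧ IsOpenCover V 𝒱 ∧
      ∀ U' ∈ 𝒰, ∀ V' ∈ 𝒱, ∃ (W' : RelOpen E X S) (f : W' ⟶ W),
        T f ∧ U' ×ˢ V' ⊆ (W'.1 : Set (X × S))

/-- The coverings of `X_sa × S`. -/
def relCoverage : Coverage (RelOpen E X S) where
  coverings W := {T | IsRelCover X W T}
  pullback := by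
    intro W W₁ f T hT
    refine ⟨fun Z _ => ∃ (W' : RelOpen E X S) (g : W' ⟶ W), T g ∧ Z ≤ W', ?_, ?_⟩
    · intro U V hU hV hUV
      obtain ⟨𝒰, 𝒱, h𝒰, h𝒱, h⟩ := hT U V hU hV (hUV.trans (leOfHom f))
      refine ⟨𝒰, 𝒱, h𝒰, h𝒱, fun U' hU' V' hV' => ?_⟩
      obtain ⟨W', g, hg, hsub⟩ := h U' hU' V' hV'
      have h1 : IsSaOpen E U' := (h𝒰.1 U' hU').1
      have h2 : IsOpen V' := h𝒱.1 V' hV'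
      have h3 : U' ×ˢ V' ⊆ (W₁.1 : Set (X × S)) :=
        (Set.prod_mono (h𝒰.1 U' hU').2 (h𝒱.2 ▸ Set.subset_sUnion_of_mem hV')).trans hUV
      exact ⟨⟨⟨U' ×ˢ V', h1.1.prod h2⟩,
        ⟨{U' ×ˢ V'}, Set.finite_singleton _, by rintro _ rfl; exact ⟨U', V', h1, h2, rfl⟩, by simp⟩⟩,
        homOfLE h3, ⟨W', g, hg, hsub⟩, subset_rfl⟩
    · rintro Z i ⟨W', g, hg, hle⟩
      exact ⟨W', homOfLE hle, g, hg, Subsingleton.elim _ _⟩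

/-- The topology of the site `X_sa × S`, generated by its coverings. -/
def relTopology : GrothendieckTopology (RelOpen E X S) := (relCoverage E X S).toGrothendieck

/-! ### The functors between the categories of open subsets -/

/-- The inclusion `𝒯 ⊆ op(X_sa × S_sa)`. -/
def boxToBiSa : Box E F X S ⥤ BiSaOpen E F X S :=
  Monotone.functor (f := fun R => ⟨R.1, R.2.isBiSaOpen⟩) fun _ _ h => h

/-- The inclusion `𝒯 ⊆ op(X_sa × S)`. -/
def boxToRel : Box E F X S ⥤ RelOpen E X S :=
  Monotone.functor (f := fun R => ⟨R.1, R.2.isRelOpen⟩) fun _ _ h => h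

/-- The inclusion `op(X_sa × S_sa) ⊆ op(X × S)`. -/
def biSaToOpens : BiSaOpen E F X S ⥤ Opens (X × S) :=
  Monotone.functor (f := fun W => W.1) fun _ _ h => h

/-- The inclusion `op(X_sa × S) ⊆ op(X × S)`. -/
def relToOpens : RelOpen E X S ⥤ Opens (X × S) :=
  Monotone.functor (f := fun W => W.1) fun _ _ h => h

theorem compatiblePreserving_of_inf {C D : Type} [PartialOrder C] [PartialOrder D]
    (K : GrothendieckTopology D) (G : C ⥤ D)
    (h : ∀ a b : C, ∃ c, c ≤ a ∧ c ≤ b ∧ ∀ d, d ≤ G.obj a → d ≤ G.obj b → d ≤ G.obj c) :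
    CompatiblePreserving.{0} K G := by
  constructor
  intro ℱ Z T x hx Y₁ Y₂ X f₁ f₂ g₁ g₂ hg₁ hg₂ _
  obtain ⟨c, h1, h2, h3⟩ := h Y₁ Y₂
  have e1 : f₁ = homOfLE (h3 X (leOfHom f₁) (leOfHom f₂)) ≫ G.map (homOfLE h1) :=
    Subsingleton.elim _ _
  have e2 : f₂ = homOfLE (h3 X (leOfHom f₁) (leOfHom f₂)) ≫ G.map (homOfLE h2) :=
    Subsingleton.elim _ _
  have := hx (homOfLE h1) (homOfLE h2) hg₁ hg₂ (Subsingleton.elim _ _)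
  rw [e1, e2]
  simp only [op_comp, Functor.map_comp, types_comp_apply]
  exact congrArg _ this

instance : (boxToBiSa E F X S).IsContinuous (boxTopology E F X S) (biSaTopology E F X S) := by
  refine Functor.isContinuous_of_coverPreserving (compatiblePreserving_of_inf _ _ ?_) ⟨?_⟩
  · exact fun R R' => ⟨⟨R.1 ⊓ R'.1, R.2.inter R'.2⟩, (inf_le_left : R.1 ⊓ R'.1 ≤ R.1),
      (inf_le_right : R.1 ⊓ R'.1 ≤ R'.1), fun d h h' => (le_inf h h' : d.1 ≤ R.1 ⊓ R'.1)⟩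
  · rintro R T ⟨Φ, hΦ, hT, hR⟩ Q hQ
    refine ⟨(boxToBiSa E F X S).obj '' Φ, hΦ.image _, ?_, ?_⟩
    · rintro _ ⟨R', hR', rfl⟩
      obtain ⟨f, hf⟩ := hT R' hR'
      exact ⟨_, Sieve.image_mem_functorPushforward (boxToBiSa E F X S) T hf⟩
    · intro y hy
      obtain ⟨R', hR', hyR'⟩ := Set.mem_iUnion₂.1 (hR (hQ hy))
      exact Set.mem_iUnion₂.2 ⟨_, ⟨R', hR', rfl⟩, hyR'⟩

instance : (boxToRel E F X S).IsContinuous (boxTopology E F X S) (relTopology E X S) := by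
  refine Functor.isContinuous_of_coverPreserving (compatiblePreserving_of_inf _ _ ?_) ⟨?_⟩
  · exact fun R R' => ⟨⟨R.1 ⊓ R'.1, R.2.inter R'.2⟩, (inf_le_left : R.1 ⊓ R'.1 ≤ R.1),
      (inf_le_right : R.1 ⊓ R'.1 ≤ R'.1), fun d h h' => (le_inf h h' : d.1 ≤ R.1 ⊓ R'.1)⟩
  · rintro R T ⟨Φ, hΦ, hT, hR⟩
    have hgen : IsRelCover X ((boxToRel E F X S).obj R)
        (T.functorPushforward (boxToRel E F X S)).arrows := by
      intro U V hU hV hUV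
      have key : ∀ Q : Box E F X S, ∃ (A : Set X) (B : Set S), IsSaOpen E A ∧ IsOpen B ∧
          (Q.1 : Set (X × S)) = A ×ˢ B := fun Q => by
        obtain ⟨A, B, ⟨hA, -⟩, ⟨hB, -⟩, h⟩ := Q.2
        exact ⟨A, B, hA, hB.1, h⟩
      choose A B hA hB hAB using key
      have hA' : ∀ Ψ : Set (Box E F X S), Ψ.Finite → IsSaOpen E (U ∩ ⋂ Q ∈ Ψ, A Q) := by
        intro Ψ hΨ
        induction Ψ, hΨ using Set.Finite.induction_on with
        | empty => simpa using hU
        | insert _ _ ih =>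
          rw [Set.biInter_insert, Set.inter_left_comm]
          exact (hA _).inter ih
      refine ⟨(fun x => U ∩ ⋂ Q ∈ {Q ∈ Φ | x ∈ A Q}, A Q) '' U,
        (fun s => V ∩ ⋂ Q ∈ {Q ∈ Φ | s ∈ B Q}, B Q) '' V, ⟨?_, ?_⟩, ⟨?_, ?_⟩, ?_⟩
      · rintro _ ⟨x, -, rfl⟩
        exact ⟨hA' _ (hΦ.subset (Set.sep_subset _ _)), Set.inter_subset_left⟩
      · intro K _
        refine ⟨_, subset_rfl, ?_, ?_⟩
        · refine (hΦ.finite_subsets.image fun Ψ => U ∩ ⋂ Q ∈ Ψ, A Q).subset ?_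
          rintro _ ⟨x, -, rfl⟩
          exact ⟨_, Set.sep_subset _ _, rfl⟩
        · congr 1
          apply subset_antisymm
          · refine Set.sUnion_subset ?_
            rintro _ ⟨x, -, rfl⟩
            exact Set.inter_subset_left
          · intro x hx
            exact ⟨_, ⟨x, hx, rfl⟩, hx, Set.mem_iInter₂.2 fun Q hQ => hQ.2⟩
      · rintro _ ⟨s, -, rfl⟩
        exact hV.inter ((hΦ.subset (Set.sep_subset _ _)).isOpen_biInter fun Q _ => hB Q)
      · apply subset_antisymm
        · refine Set.sUnion_subset ?_
          rintro _ ⟨x, -, rfl⟩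
          exact Set.inter_subset_left
        · intro x hx
          exact ⟨_, ⟨x, hx, rfl⟩, hx, Set.mem_iInter₂.2 fun Q hQ => hQ.2⟩
      · rintro _ ⟨x, hx, rfl⟩ _ ⟨s, hs, rfl⟩
        obtain ⟨Q, hQ, hxs⟩ := Set.mem_iUnion₂.1 (hR (hUV (Set.mk_mem_prod hx hs)))
        rw [hAB Q] at hxs
        obtain ⟨f, hf⟩ := hT Q hQ
        refine ⟨_, _, Sieve.image_mem_functorPushforward (boxToRel E F X S) T hf, ?_⟩
        change _ ⊆ (Q.1 : Set (X × S))
        rw [hAB Q]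
        exact Set.prod_mono
          (Set.inter_subset_right.trans (Set.biInter_subset_of_mem ⟨hQ, hxs.1⟩))
          (Set.inter_subset_right.trans (Set.biInter_subset_of_mem ⟨hQ, hxs.2⟩))
    have := Coverage.Saturate.of (K := relCoverage E X S) _ _ hgen
    rwa [Sieve.generate_sieve] at this

instance : (biSaToOpens E F X S).IsContinuous (biSaTopology E F X S)
    (Opens.grothendieckTopology (X × S)) := by
  refine Functor.isContinuous_of_coverPreserving (compatiblePreserving_of_inf _ _ ?_) ⟨?_⟩
  · exact fun R R' => ⟨⟨R.1 ⊓ R'.1, R.2.inter R'.2⟩, (inf_le_left : R.1 ⊓ R'.1 ≤ R.1),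
      (inf_le_right : R.1 ⊓ R'.1 ≤ R'.1), fun d h h' => (le_inf h h' : d ≤ R.1 ⊓ R'.1)⟩
  · rintro W T hT y hy
    obtain ⟨𝓑, h𝓑, -, hW⟩ := W.2
    have hy' : y ∈ (W.1 : Set (X × S)) := hy
    rw [hW] at hy'
    obtain ⟨R, hR, hyR⟩ := hy'
    have hRW : R ⊆ (W.1 : Set (X × S)) := hW ▸ Set.subset_sUnion_of_mem hR
    obtain ⟨Φ, -, hΦT, hΦ⟩ := hT ⟨⟨R, (h𝓑 R hR).isOpen⟩, h𝓑 R hR⟩ hRW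
    obtain ⟨W', hW', hyW'⟩ := Set.mem_iUnion₂.1 (hΦ hyR)
    obtain ⟨f, hf⟩ := hΦT W' hW'
    exact ⟨_, _, Sieve.image_mem_functorPushforward (biSaToOpens E F X S) T hf, hyW'⟩

instance : (relToOpens E X S).IsContinuous (relTopology E X S)
    (Opens.grothendieckTopology (X × S)) := by
  refine Functor.isContinuous_of_coverPreserving (compatiblePreserving_of_inf _ _ ?_) ⟨?_⟩
  · exact fun R R' => ⟨⟨R.1 ⊓ R'.1, R.2.inter R'.2⟩, (inf_le_left : R.1 ⊓ R'.1 ≤ R.1),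
      (inf_le_right : R.1 ⊓ R'.1 ≤ R'.1), fun d h h' => (le_inf h h' : d ≤ R.1 ⊓ R'.1)⟩
  · rintro W T hT y hy
    have key : ∀ y ∈ W.1, ∃ (W' : RelOpen E X S) (f : W' ⟶ W), T f ∧ y ∈ W'.1 := by
      clear hy y
      induction hT with
      | of W T hT =>
        rintro ⟨x, s⟩ hy
        obtain ⟨𝓟, -, h𝓟, hW⟩ := W.2
        have hy' : (x, s) ∈ (W.1 : Set (X × S)) := hy
        rw [hW] at hy'
        obtain ⟨P, hP, hyP⟩ := hy'
        have hPW : P ⊆ (W.1 : Set (X × S)) := hW ▸ Set.subset_sUnion_of_mem hP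
        obtain ⟨U, V, hU, hV, rfl⟩ := h𝓟 P hP
        obtain ⟨𝒰, 𝒱, h𝒰, h𝒱, h⟩ := hT U V hU hV hPW
        obtain ⟨𝒰₀, hsub, -, hK⟩ := h𝒰.2 {x} isCompact_singleton
        obtain ⟨-, U', hU', hxU'⟩ : x ∈ {x} ∩ ⋃₀ 𝒰₀ := hK ▸ ⟨rfl, hyP.1⟩
        obtain ⟨V', hV', hsV'⟩ : s ∈ ⋃₀ 𝒱 := h𝒱.2 ▸ hyP.2
        obtain ⟨W', f, hf, hle⟩ := h U' (hsub hU') V' hV'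
        exact ⟨W', f, Sieve.le_generate T _ _ hf, hle ⟨hxU', hsV'⟩⟩
      | top W => exact fun y hy => ⟨W, 𝟙 W, trivial, hy⟩
      | transitive W T T' _ _ ih ih' =>
        intro y hy
        obtain ⟨W', f, hf, hyW'⟩ := ih y hy
        obtain ⟨W'', g, hg, hyW''⟩ := ih' hf y hyW'
        exact ⟨W'', g ≫ f, hg, hyW''⟩
    obtain ⟨W', f, hf, hyW'⟩ := key y hy
    exact ⟨_, _, Sieve.image_mem_functorPushforward (relToOpens E X S) T hf, hyW'⟩

/-! ### The categories of sheaves of complex vector spaces and the functors between them -/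

/-- `Mod(ℂ_{X × S})`. -/
abbrev ModTop : Type 1 := Sheaf (Opens.grothendieckTopology (X × S)) (ModuleCat.{0} ℂ)

/-- `Mod(ℂ_{X_sa × S_sa})`. -/
abbrev ModBiSa : Type 1 := Sheaf (biSaTopology E F X S) (ModuleCat.{0} ℂ)

/-- `Mod(ℂ_{X_sa × S})`. -/
abbrev ModRel : Type 1 := Sheaf (relTopology E X S) (ModuleCat.{0} ℂ)

/-- The inverse image `ρ'⁻¹` of the morphism of sites `ρ' : X × S → X_sa × S_sa`. -/
def rhoPrimeInv : ModBiSa E F X S ⥤ ModTop X S :=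
  (biSaToOpens E F X S).sheafPullback (ModuleCat.{0} ℂ) (biSaTopology E F X S)
    (Opens.grothendieckTopology (X × S))

/-- The inverse image `ρ_S⁻¹` of the morphism of sites `ρ_S : X × S → X_sa × S`. -/
def rhoSInv : ModRel E X S ⥤ ModTop X S :=
  (relToOpens E X S).sheafPullback (ModuleCat.{0} ℂ) (relTopology E X S)
    (Opens.grothendieckTopology (X × S))

/-- The inverse image `a⁻¹` of the morphism of sites `a : X_sa × S → X_sa × S_sa`. This morphism
is given by the inclusion of the basis `𝒯` of `X_sa × S_sa` in `op(X_sa × S)` (an infinite locally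
finite union of elements of `𝒯` need not lie in `op(X_sa × S)`); accordingly `a⁻¹ G` is
the inverse image, along `𝒯 ⊆ op(X_sa × S)`, of the restriction of `G` to the basis `𝒯`. -/
def aInv : ModBiSa E F X S ⥤ ModRel E X S :=
  (boxToBiSa E F X S).sheafPushforwardContinuous (ModuleCat.{0} ℂ) (boxTopology E F X S)
      (biSaTopology E F X S) ⋙
    (boxToRel E F X S).sheafPullback (ModuleCat.{0} ℂ) (boxTopology E F X S) (relTopology E X S)

end Sites

/-! ### Inverse images and tensor products -/

section Tensor

variable {C D : Type} [SmallCategory C] [SmallCategory D]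

/-- The canonical morphism from the presheaf tensor product of two sheaves to their tensor product
as sheaves (which is the associated sheaf of the former). -/
def toSheafTensor (K : GrothendieckTopology D) (A B : Sheaf K (ModuleCat.{0} ℂ)) :
    A.obj ⊗ B.obj ⟶ (A ⊗ B).obj :=
  letI := (sheafificationAdjunction K (ModuleCat.{0} ℂ)).rightAdjointLaxMonoidal
  Functor.LaxMonoidal.μ (sheafToPresheaf K (ModuleCat.{0} ℂ)) A B

variable {J : GrothendieckTopology C}

/-- The morphism `A ⊗ B ⟶ H` of sheaves determined by a morphism of presheaves from the presheaf
tensor product of `A` and `B` to `H`. -/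
def sheafTensorLift {A B H : Sheaf J (ModuleCat.{0} ℂ)} (φ : A.obj ⊗ B.obj ⟶ H.obj) : A ⊗ B ⟶ H :=
  (inv ((sheafificationAdjunction J (ModuleCat.{0} ℂ)).counit.app A) ⊗ₘ
      inv ((sheafificationAdjunction J (ModuleCat.{0} ℂ)).counit.app B)) ≫
    Functor.LaxMonoidal.μ (presheafToSheaf J (ModuleCat.{0} ℂ)) A.obj B.obj ≫
    ((sheafificationAdjunction J (ModuleCat.{0} ℂ)).homEquiv (A.obj ⊗ B.obj) H).symm φ

theorem toSheafTensor_sheafTensorLift {A B H : Sheaf J (ModuleCat.{0} ℂ)}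
    (φ : A.obj ⊗ B.obj ⟶ H.obj) : toSheafTensor J A B ≫ (sheafTensorLift φ).hom = φ := by
  let adj := sheafificationAdjunction J (ModuleCat.{0} ℂ)
  change adj.homEquiv _ _ (Functor.OplaxMonoidal.δ (presheafToSheaf J (ModuleCat.{0} ℂ)) A.obj B.obj
    ≫ (adj.counit.app A ⊗ₘ adj.counit.app B)) ≫ (sheafToPresheaf J (ModuleCat.{0} ℂ)).map (sheafTensorLift φ) = φ
  rw [← adj.homEquiv_naturality_right, ← Equiv.eq_symm_apply]
  rw [sheafTensorLift, Category.assoc]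
  erw [tensorHom_comp_tensorHom_assoc]
  simp [adj]

/-- The canonical morphism `u⁻¹(A ⊗ B) ⟶ u⁻¹A ⊗ u⁻¹B` for the inverse image `u⁻¹` of a morphism
of sites given by the continuous functor `u`: it corresponds to the morphism
`A ⊗ B ⟶ u_*(u⁻¹A ⊗ u⁻¹B)` which sends a tensor `a ⊗ b` of sections over `W` to the tensor of the
images of `a` and `b` in `(u⁻¹A)(u W)` and `(u⁻¹B)(u W)`. -/
def pullbackTensor (u : C ⥤ D) (J : GrothendieckTopology C) (K : GrothendieckTopology D)
    [u.IsContinuous J K] (A B : Sheaf J (ModuleCat.{0} ℂ)) :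
    (u.sheafPullback (ModuleCat.{0} ℂ) J K).obj (A ⊗ B) ⟶
      (u.sheafPullback (ModuleCat.{0} ℂ) J K).obj A ⊗
        (u.sheafPullback (ModuleCat.{0} ℂ) J K).obj B :=
  let adj := u.sheafAdjunctionContinuous (ModuleCat.{0} ℂ) J K
  let R := (Functor.whiskeringLeft _ _ (ModuleCat.{0} ℂ)).obj u.op
  (adj.homEquiv _ _).symm (sheafTensorLift
    (((adj.unit.app A).hom ⊗ₘ (adj.unit.app B).hom) ≫
      Functor.LaxMonoidal.μ R _ _ ≫ R.map (toSheafTensor K _ _)))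

end Tensor

end RelSubanalytic

end

open RelSubanalytic

/-! For an inclusion `u` of a site `(C, J)` of open sets in the opens of a space `Z`, the inverse
image `u⁻¹` has an explicit form, and so does its left adjoint. Two functors on presheaves do the
work. `closureExt` sends `F` to `c ↦ colim F(W)` over open `W` containing the closure of `u c`.
`innerSections` sends `G` to `W ↦ lim G(c)` over `c` with closure of `u c` inside `W`. Both classify
families of maps `F(W) ⟶ G(c)` indexed by the same pairs, so the first is left adjoint to the
second.

Suppose objects with small closure are abundant (`IsInnerBasis`). Then `innerSections` takes sheaves
to sheaves (`IsInnerBasis.isSheaf`), and a sheaf on `Z` is recovered from its families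
(`IsInnerBasis.isIso_toInnerSections`). Hence `innerSections` on sheaves is left adjoint to `u_*`,
that is, it is `u⁻¹`. Therefore `shriek`, the sheafification of `closureExt`, is left adjoint to
`u⁻¹`. The colimits are filtered, so `shriek` is left exact, and it commutes with tensor products
because filtered colimits and sheafification do.

The unit `A ⟶ u⁻¹ (shriek A)` is invertible. Its inverse `shriekCoreflection` is induced by
restricting a germ along the closure of `u c` to `u c`. The compatibility of the tensor isomorphism
with units thus becomes the fact that restriction of germs respects tensors
(`closureExtTensor_res`).

Relatively compact boxes form an inner basis because their closures are compact; the objects of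
`X_sa × S` inherit the property by being covered by boxes. Boxes are a dense subsite of `X_sa ×
S_sa`, and restriction from `X_sa × S` to boxes is fully faithful. So `ρ'_!` is `shriek` for boxes
followed by inverse image, and composing with `a⁻¹` gives another left adjoint of `ρ_S⁻¹`. By
uniqueness it is `shriek` for `X_sa × S`, whose properties are then transported. -/

noncomputable section

open Opposite Limits

namespace RelSubanalytic

/-! ### Extension of presheaves to closures -/

section ClosureExtension

variable {Z C : Type} [TopologicalSpace Z] [Preorder C]

/-- The inclusion of the open subsets in all subsets. -/
def opensToSet (Z : Type) [TopologicalSpace Z] : Opens Z ⥤ Set Z :=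
  Monotone.functor (f := fun W => (W : Set Z)) fun _ _ h => h

/-- The functor which sends `c` to the closure of `u c`. -/
def closureFunctor (u : C ⥤ Opens Z) : C ⥤ Set Z :=
  Monotone.functor (f := fun c => closure (u.obj c : Set Z)) fun _ _ h =>
    closure_mono (leOfHom (u.map (homOfLE h)))

/-- The open neighbourhoods of any subset are stable under finite intersections. This is what makes
the colimits over neighbourhoods filtered. -/
instance : RepresentablyFlat (opensToSet Z) where
  cofiltered K :=
    have : Nonempty (StructuredArrow K (opensToSet Z)) :=
      ⟨StructuredArrow.mk (Y := (⊤ : Opens Z)) (homOfLE (Set.subset_univ K))⟩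
    { cone_objs := fun P Q =>
        ⟨StructuredArrow.mk (Y := P.right ⊓ Q.right)
          (homOfLE (Set.subset_inter (leOfHom P.hom) (leOfHom Q.hom))),
          StructuredArrow.homMk (homOfLE inf_le_left) (Subsingleton.elim _ _),
          StructuredArrow.homMk (homOfLE inf_le_right) (Subsingleton.elim _ _), trivial⟩
      cone_maps := fun P _ _ _ =>
        ⟨P, 𝟙 P, congrArg _ (StructuredArrow.hom_ext _ _ (Subsingleton.elim _ _))⟩ }

variable (u : C ⥤ Opens Z)

/-- The presheaf `c ↦ colim F(W)`, where `W` runs over the open neighbourhoods of the closure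
of `u c`. -/
def closureExt : ((Opens Z)ᵒᵖ ⥤ ModuleCat.{0} ℂ) ⥤ (Cᵒᵖ ⥤ ModuleCat.{0} ℂ) :=
  (opensToSet Z).op.lan ⋙ (Functor.whiskeringLeft _ _ _).obj (closureFunctor u).op

instance : PreservesFiniteLimits (closureExt u) := by
  have : PreservesFiniteLimits ((opensToSet Z).op.lan :
      ((Opens Z)ᵒᵖ ⥤ ModuleCat.{0} ℂ) ⥤ ((Set Z)ᵒᵖ ⥤ ModuleCat.{0} ℂ)) :=
    lan_preservesFiniteLimits_of_flat (ModuleCat.{0} ℂ) (opensToSet Z)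
  exact comp_preservesFiniteLimits _ _

/-- The inclusion of the closure of `u c` in `W`. -/
def closureHom {u : C ⥤ Opens Z} {c : C} {W : Opens Z} (h : closure (u.obj c : Set Z) ⊆ W) :
    (closureFunctor u).obj c ⟶ (opensToSet Z).obj W :=
  homOfLE h

/-- The inclusion of `u c` in a neighbourhood of its closure. -/
def closureSubsetHom {u : C ⥤ Opens Z} {c : C} {W : Opens Z}
    (h : closure (u.obj c : Set Z) ⊆ W) : u.obj c ⟶ W :=
  homOfLE (show (u.obj c : Set Z) ⊆ W from subset_closure.trans h)

/-- The germ along the closure of `u c` of a section over a neighbourhood. -/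
def germ (F : (Opens Z)ᵒᵖ ⥤ ModuleCat.{0} ℂ) {c : C} {W : Opens Z}
    (h : closure (u.obj c : Set Z) ⊆ W) : F.obj (op W) ⟶ ((closureExt u).obj F).obj (op c) :=
  ((opensToSet Z).op.lanUnit.app F).app (op W) ≫
    ((opensToSet Z).op.lan.obj F).map (closureHom h).op

variable {u}

theorem germ_map (F : (Opens Z)ᵒᵖ ⥤ ModuleCat.{0} ℂ) {c d : C} {W : Opens Z}
    (h : closure (u.obj c : Set Z) ⊆ W) (f : d ⟶ c) :
    germ u F h ≫ ((closureExt u).obj F).map f.op =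
      germ u F ((closure_mono (leOfHom (u.map f))).trans h) := by
  dsimp only [germ, closureExt, Functor.comp_obj, Functor.whiskeringLeft_obj_obj]
  rw [Category.assoc]
  congr 1
  exact (((opensToSet Z).op.lan.obj F).map_comp _ _).symm

theorem map_germ (F : (Opens Z)ᵒᵖ ⥤ ModuleCat.{0} ℂ) {c : C} {W W' : Opens Z}
    (h : closure (u.obj c : Set Z) ⊆ W) (f : W ⟶ W') :
    F.map f.op ≫ germ u F h = germ u F (h.trans (leOfHom f)) := by
  have h₁ := ((opensToSet Z).op.lanUnit.app F).naturality f.op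
  have h₂ := ((opensToSet Z).op.lan.obj F).map_comp ((opensToSet Z).map f).op (closureHom h).op
  refine (Category.assoc _ _ _).symm.trans ((congrArg (fun t => t ≫
    ((opensToSet Z).op.lan.obj F).map (closureHom h).op) h₁).trans ((Category.assoc _ _ _).trans ?_))
  exact congrArg (fun t => ((opensToSet Z).op.lanUnit.app F).app (op W') ≫ t) h₂.symm

theorem germ_naturality {F G : (Opens Z)ᵒᵖ ⥤ ModuleCat.{0} ℂ} (φ : F ⟶ G) {c : C} {W : Opens Z}
    (h : closure (u.obj c : Set Z) ⊆ W) :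
    germ u F h ≫ ((closureExt u).map φ).app (op c) = φ.app (op W) ≫ germ u G h := by
  have := NatTrans.congr_app ((opensToSet Z).op.lanUnit.naturality φ) (op W)
  dsimp only [germ, closureExt, Functor.comp_map, Functor.whiskeringLeft_obj_map] at this ⊢
  refine (Category.assoc _ _ _).trans ?_
  refine (congrArg _ (((opensToSet Z).op.lan.map φ).naturality (closureHom h).op)).trans ?_
  exact (Category.assoc _ _ _).symm.trans ((congrArg (fun t => t ≫
    ((opensToSet Z).op.lan.obj G).map (closureHom h).op) this.symm).trans
    (Category.assoc _ _ _))

variable (u) in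
/-- The stalk cocone of `F` along the closure of `u c`. -/
def germCocone (F : (Opens Z)ᵒᵖ ⥤ ModuleCat.{0} ℂ) (c : C) :
    Cocone (CostructuredArrow.proj (opensToSet Z).op (op (closure (u.obj c : Set Z))) ⋙ F) where
  pt := ((closureExt u).obj F).obj (op c)
  ι :=
    { app := fun P => germ u F (W := P.left.unop) (leOfHom P.hom.unop)
      naturality := fun P Q f => by
        dsimp
        exact (map_germ F _ f.left.unop).trans (Category.comp_id _).symm }

variable (u) in
/-- The germs exhibit `closureExt` as a colimit. -/
def isColimitGermCocone (F : (Opens Z)ᵒᵖ ⥤ ModuleCat.{0} ℂ) (c : C) :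
    IsColimit (germCocone u F c) :=
  Functor.isPointwiseLeftKanExtensionLeftKanExtensionUnit (opensToSet Z).op F
    (op (closure (u.obj c : Set Z)))

theorem closureExt_hom_ext {F : (Opens Z)ᵒᵖ ⥤ ModuleCat.{0} ℂ} {c : C} {M : ModuleCat.{0} ℂ}
    {f g : ((closureExt u).obj F).obj (op c) ⟶ M}
    (h : ∀ (W : Opens Z) (hW : closure (u.obj c : Set Z) ⊆ W), germ u F hW ≫ f = germ u F hW ≫ g) :
    f = g :=
  (isColimitGermCocone u F c).hom_ext fun P => h P.left.unop (leOfHom P.hom.unop)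

theorem closureExt_natTrans_ext {F : (Opens Z)ᵒᵖ ⥤ ModuleCat.{0} ℂ} {G : Cᵒᵖ ⥤ ModuleCat.{0} ℂ}
    {f g : (closureExt u).obj F ⟶ G}
    (h : ∀ (c : C) (W : Opens Z) (hW : closure (u.obj c : Set Z) ⊆ W),
      germ u F hW ≫ f.app (op c) = germ u F hW ≫ g.app (op c)) : f = g :=
  NatTrans.ext (funext fun c => closureExt_hom_ext (h c.unop))

/-- The morphism out of `closureExt` determined by a compatible family of morphisms. -/
def closureExtDesc {F : (Opens Z)ᵒᵖ ⥤ ModuleCat.{0} ℂ} {G : Cᵒᵖ ⥤ ModuleCat.{0} ℂ}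
    (φ : ∀ (c : C) (W : Opens Z), closure (u.obj c : Set Z) ⊆ W → (F.obj (op W) ⟶ G.obj (op c)))
    (h₁ : ∀ (c : C) (W W' : Opens Z) (hW : closure (u.obj c : Set Z) ⊆ W) (f : W ⟶ W'),
      F.map f.op ≫ φ c W hW = φ c W' (hW.trans (leOfHom f)))
    (h₂ : ∀ (c d : C) (W : Opens Z) (hW : closure (u.obj c : Set Z) ⊆ W) (f : d ⟶ c),
      φ c W hW ≫ G.map f.op = φ d W ((closure_mono (leOfHom (u.map f))).trans hW)) :
    (closureExt u).obj F ⟶ G where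
  app c := (isColimitGermCocone u F c.unop).desc
    { pt := G.obj c
      ι :=
        { app := fun P => φ c.unop P.left.unop (leOfHom P.hom.unop)
          naturality := fun P Q f => by
            dsimp
            exact (h₁ _ _ _ _ f.left.unop).trans (Category.comp_id _).symm } }
  naturality c d f := by
    refine closureExt_hom_ext fun W hW => ?_
    have h := germ_map F hW f.unop
    rw [Quiver.Hom.op_unop] at h
    erw [reassoc_of% h]
    have key : ∀ (c : Cᵒᵖ) (hc : closure (u.obj c.unop : Set Z) ⊆ W), germ u F hc ≫ _ = φ _ W hc :=
      fun c hc => (isColimitGermCocone u F c.unop).fac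
        { pt := G.obj c
          ι :=
            { app := fun P => φ c.unop P.left.unop (leOfHom P.hom.unop)
              naturality := fun P Q f => by
                dsimp
                exact (h₁ _ _ _ _ f.left.unop).trans (Category.comp_id _).symm } } (CostructuredArrow.mk (Y := op W) (homOfLE hc).op)
    erw [key d, ← Category.assoc, key c]
    exact (h₂ _ _ _ _ f.unop).symm

@[simp]
theorem germ_closureExtDesc {F : (Opens Z)ᵒᵖ ⥤ ModuleCat.{0} ℂ} {G : Cᵒᵖ ⥤ ModuleCat.{0} ℂ}
    (φ : ∀ (c : C) (W : Opens Z), closure (u.obj c : Set Z) ⊆ W → (F.obj (op W) ⟶ G.obj (op c)))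
    (h₁ h₂) {c : C} {W : Opens Z} (hW : closure (u.obj c : Set Z) ⊆ W) :
    germ u F hW ≫ (closureExtDesc φ h₁ h₂).app (op c) = φ c W hW :=
  (isColimitGermCocone u F c).fac _ (CostructuredArrow.mk (Y := op W) (homOfLE hW).op)

/-! #### Tensor products -/

/-- The morphism `[a ⊗ b] ↦ [a] ⊗ [b]`. -/
def closureExtTensor (F G : (Opens Z)ᵒᵖ ⥤ ModuleCat.{0} ℂ) :
    (closureExt u).obj (F ⊗ G) ⟶ (closureExt u).obj F ⊗ (closureExt u).obj G :=
  closureExtDesc (fun _ _ h => germ u F h ⊗ₘ germ u G h)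
    (fun c W W' hW f => by
      dsimp
      rw [tensorHom_comp_tensorHom, map_germ, map_germ])
    (fun c d W hW f => by
      dsimp
      rw [tensorHom_comp_tensorHom, germ_map, germ_map])

@[simp]
theorem germ_closureExtTensor (F G : (Opens Z)ᵒᵖ ⥤ ModuleCat.{0} ℂ) {c : C} {W : Opens Z}
    (hW : closure (u.obj c : Set Z) ⊆ W) :
    germ u (F ⊗ G) hW ≫ (closureExtTensor F G).app (op c) = germ u F hW ⊗ₘ germ u G hW :=
  germ_closureExtDesc _ _ _ _

/-- The tensor product preserves colimits in each variable, which gives a colimit over pairs of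
neighbourhoods. The neighbourhoods are filtered, hence sifted, so the diagonal is final among pairs.
-/
instance (F G : (Opens Z)ᵒᵖ ⥤ ModuleCat.{0} ℂ) : IsIso (closureExtTensor (u := u) F G) := by
  have : ∀ c, IsIso ((closureExtTensor (u := u) F G).app c) := by
    intro c
    have : IsFiltered (CostructuredArrow (opensToSet Z).op (op (closure (u.obj c.unop : Set Z)))) :=
      inferInstance
    have : IsSifted (CostructuredArrow (opensToSet Z).op
      (op (closure (u.obj c.unop : Set Z)))) := IsFiltered.isSifted
    let e := IsColimit.coconePointUniqueUpToIso (isColimitGermCocone u (F ⊗ G) c.unop)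
      ((isColimitGermCocone u F c.unop).tensor (isColimitGermCocone u G c.unop))
    have he : (closureExtTensor (u := u) F G).app c = e.hom := by
      refine closureExt_hom_ext fun W hW => ?_
      refine (germ_closureExtTensor _ _ hW).trans ?_
      exact (IsColimit.comp_coconePointUniqueUpToIso_hom (isColimitGermCocone u (F ⊗ G) c.unop)
        ((isColimitGermCocone u F c.unop).tensor (isColimitGermCocone u G c.unop))
        (CostructuredArrow.mk (Y := op W) (homOfLE hW).op)).symm
    rw [he]
    exact e.isIso_hom
  exact NatIso.isIso_of_isIso_app _

theorem closureExtTensor_naturality {F F' G G' : (Opens Z)ᵒᵖ ⥤ ModuleCat.{0} ℂ} (φ : F ⟶ F')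
    (ψ : G ⟶ G') : (closureExt u).map (φ ⊗ₘ ψ) ≫ closureExtTensor F' G' =
      closureExtTensor F G ≫ ((closureExt u).map φ ⊗ₘ (closureExt u).map ψ) := by
  refine closureExt_natTrans_ext fun c W hW => ?_
  simp only [NatTrans.comp_app, reassoc_of% (@germ_naturality), germ_closureExtTensor,
    reassoc_of% (@germ_closureExtTensor)]
  erw [tensorHom_comp_tensorHom, tensorHom_comp_tensorHom]
  rw [germ_naturality, germ_naturality]

/-! #### Restriction from the closure to the open subset -/

/-- The morphism which sends a germ along the closure of `u c` to its restriction to `u c`. -/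
def closureExtRes (F : (Opens Z)ᵒᵖ ⥤ ModuleCat.{0} ℂ) : (closureExt u).obj F ⟶ u.op ⋙ F :=
  closureExtDesc (fun _ _ h => F.map (closureSubsetHom h).op)
    (fun c W W' hW f => by
      exact (F.map_comp _ _).symm)
    (fun c d W hW f => (F.map_comp _ _).symm)

@[simp]
theorem germ_closureExtRes (F : (Opens Z)ᵒᵖ ⥤ ModuleCat.{0} ℂ) {c : C} {W : Opens Z}
    (hW : closure (u.obj c : Set Z) ⊆ W) :
    germ u F hW ≫ (closureExtRes F).app (op c) = F.map (closureSubsetHom hW).op :=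
  germ_closureExtDesc _ _ _ _

theorem closureExtRes_naturality {F G : (Opens Z)ᵒᵖ ⥤ ModuleCat.{0} ℂ} (φ : F ⟶ G) :
    (closureExt u).map φ ≫ closureExtRes G =
      closureExtRes F ≫ ((Functor.whiskeringLeft _ _ _).obj u.op).map φ := by
  refine closureExt_natTrans_ext fun c W hW => ?_
  simp only [NatTrans.comp_app, reassoc_of% (@germ_naturality), germ_closureExtRes,
    reassoc_of% (@germ_closureExtRes)]
  exact (φ.naturality _).symm

/-- On the germ of a pure tensor both sides restrict each factor to `u c`. The compatibility with
units ultimately rests on this identity. -/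
theorem closureExtTensor_res (F G : (Opens Z)ᵒᵖ ⥤ ModuleCat.{0} ℂ) :
    closureExtTensor (u := u) F G ≫ (closureExtRes F ⊗ₘ closureExtRes G) ≫
      Functor.LaxMonoidal.μ ((Functor.whiskeringLeft _ _ (ModuleCat.{0} ℂ)).obj u.op) F G =
        closureExtRes (F ⊗ G) := by
  refine closureExt_natTrans_ext fun c W hW => ?_
  simp only [NatTrans.comp_app, germ_closureExtRes, reassoc_of% (@germ_closureExtTensor)]
  erw [Category.comp_id, tensorHom_comp_tensorHom]
  rw [germ_closureExtRes, germ_closureExtRes]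
  rfl

end ClosureExtension

/-! ### Sheaves of complex vector spaces on preordered sites, by sections -/

section Gluing

variable {C : Type} [SmallCategory C] {J : GrothendieckTopology C}

theorem eq_of_restrict_eq {P : Cᵒᵖ ⥤ ModuleCat.{0} ℂ} (hP : Presheaf.IsSheaf J P) {c : C}
    {T : Sieve c} (hT : T ∈ J c) {s t : P.obj (op c)}
    (h : ∀ (d : C) (f : d ⟶ c), T f → P.map f.op s = P.map f.op t) : s = t := by
  have hP' := (isSheaf_iff_isSheaf_of_type _ _).1
    ((Presheaf.isSheaf_iff_isSheaf_forget J P (forget _)).1 hP)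
  exact (hP' T hT).isSeparatedFor.ext fun d f hf => h d f hf

theorem exists_restrict_eq {P : Cᵒᵖ ⥤ ModuleCat.{0} ℂ} (hP : Presheaf.IsSheaf J P) {c : C}
    {T : Sieve c} (hT : T ∈ J c) (x : ∀ (d : C) (f : d ⟶ c), T f → P.obj (op d))
    (hx : ∀ (d e : C) (f : d ⟶ c) (hf : T f) (g : e ⟶ d),
      P.map g.op (x d f hf) = x e (g ≫ f) (T.downward_closed hf g)) :
    ∃ t : P.obj (op c), ∀ (d : C) (f : d ⟶ c) (hf : T f), P.map f.op t = x d f hf := by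
  have hP' := (isSheaf_iff_isSheaf_of_type _ _).1
    ((Presheaf.isSheaf_iff_isSheaf_forget J P (forget _)).1 hP)
  let y : Presieve.FamilyOfElements (P ⋙ forget _) T.arrows := fun d f hf => x d f hf
  have hy : y.Compatible := (Presieve.compatible_iff_sieveCompatible y).2
    fun d e f g hf => (hx d e f hf g).symm
  obtain ⟨t, ht, -⟩ := hP' T hT y hy
  exact ⟨t, fun d f hf => ht f hf⟩

theorem isSheaf_of_restrict {P : Cᵒᵖ ⥤ ModuleCat.{0} ℂ}
    (h₁ : ∀ (c : C) (T : Sieve c), T ∈ J c → ∀ s t : P.obj (op c),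
      (∀ (d : C) (f : d ⟶ c), T f → P.map f.op s = P.map f.op t) → s = t)
    (h₂ : ∀ (c : C) (T : Sieve c), T ∈ J c → ∀ x : ∀ (d : C) (f : d ⟶ c), T f → P.obj (op d),
      (∀ (d e : C) (f : d ⟶ c) (hf : T f) (g : e ⟶ d),
        P.map g.op (x d f hf) = x e (g ≫ f) (T.downward_closed hf g)) →
      ∃ t : P.obj (op c), ∀ (d : C) (f : d ⟶ c) (hf : T f), P.map f.op t = x d f hf) :
    Presheaf.IsSheaf J P := by
  refine (Presheaf.isSheaf_iff_isSheaf_forget J P (forget _)).2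
    ((isSheaf_iff_isSheaf_of_type _ _).2 fun c T hT x hx => ?_)
  obtain ⟨t, ht⟩ := h₂ c T hT (fun d f hf => x f hf) fun d e f hf g =>
    ((Presieve.compatible_iff_sieveCompatible x).1 hx f g hf).symm
  exact ⟨t, fun d f hf => ht d f hf, fun t' ht' =>
    h₁ c T hT t' t fun d f hf => (ht' f hf).trans (ht d f hf).symm⟩

end Gluing

/-! ### Sections by compatible families on relatively compact pieces -/

section InnerSections

variable {Z C : Type} [TopologicalSpace Z] [Preorder C] (u : C ⥤ Opens Z)

/-- The compatible families of sections of `G` over all `c` with `closure (u c) ⊆ W`. -/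
def innerFamilies (G : Cᵒᵖ ⥤ ModuleCat.{0} ℂ) (W : Opens Z) :
    Submodule ℂ (∀ c : {c : C // closure (u.obj c : Set Z) ⊆ W}, G.obj (op c.1)) where
  carrier := {s | ∀ (c d : {c : C // closure (u.obj c : Set Z) ⊆ W}) (f : d.1 ⟶ c.1),
    G.map f.op (s c) = s d}
  add_mem' hs ht c d f := by simp [hs c d f, ht c d f]
  zero_mem' c d f := by simp
  smul_mem' a s hs c d f := by simp [hs c d f]

/-- The presheaf `W ↦ lim G(c)`, where `c` runs over the objects with `closure (u c) ⊆ W`. -/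
def innerSections : (Cᵒᵖ ⥤ ModuleCat.{0} ℂ) ⥤ ((Opens Z)ᵒᵖ ⥤ ModuleCat.{0} ℂ) where
  obj G :=
    { obj := fun W => ModuleCat.of ℂ (innerFamilies u G W.unop)
      map := fun {W W'} f => ModuleCat.ofHom
        { toFun := fun s => ⟨fun c => s.1 ⟨c.1, c.2.trans (leOfHom f.unop)⟩,
            fun c d g => s.2 ⟨c.1, _⟩ ⟨d.1, _⟩ g⟩
          map_add' := fun _ _ => rfl
          map_smul' := fun _ _ => rfl } }
  map {G G'} φ :=
    { app := fun W => ModuleCat.ofHom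
        { toFun := fun s => ⟨fun c => φ.app _ (s.1 c), fun c d f => by
            dsimp only
            rw [← s.2 c d f]
            exact (NatTrans.naturality_apply φ f.op (s.1 c)).symm⟩
          map_add' := fun _ _ => Subtype.ext (funext fun _ => map_add _ _ _)
          map_smul' := fun _ _ => Subtype.ext (funext fun _ => map_smul _ _ _) } }

variable {u}

/-- The component at `c` of a compatible family. -/
def innerEval (G : Cᵒᵖ ⥤ ModuleCat.{0} ℂ) {W : Opens Z} {c : C}
    (h : closure (u.obj c : Set Z) ⊆ W) : ((innerSections u).obj G).obj (op W) ⟶ G.obj (op c) :=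
  ModuleCat.ofHom
    { toFun := fun s => s.1 ⟨c, h⟩
      map_add' := fun _ _ => rfl
      map_smul' := fun _ _ => rfl }

theorem innerSections_ext {G : Cᵒᵖ ⥤ ModuleCat.{0} ℂ} {W : Opens Z}
    {s t : ((innerSections u).obj G).obj (op W)}
    (h : ∀ (c : C) (hc : closure (u.obj c : Set Z) ⊆ W), innerEval G hc s = innerEval G hc t) :
    s = t :=
  Subtype.ext (funext fun c => h c.1 c.2)

theorem innerSections_hom_ext {G : Cᵒᵖ ⥤ ModuleCat.{0} ℂ} {W : Opens Z} {M : ModuleCat.{0} ℂ}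
    {f g : M ⟶ ((innerSections u).obj G).obj (op W)}
    (h : ∀ (c : C) (hc : closure (u.obj c : Set Z) ⊆ W),
      f ≫ innerEval G hc = g ≫ innerEval G hc) : f = g := by
  ext x
  exact innerSections_ext fun c hc => ConcreteCategory.congr_hom (h c hc) x

theorem map_innerEval (G : Cᵒᵖ ⥤ ModuleCat.{0} ℂ) {W W' : Opens Z} {c : C} (f : W' ⟶ W)
    (h : closure (u.obj c : Set Z) ⊆ W') : ((innerSections u).obj G).map f.op ≫ innerEval G h =
      innerEval G (h.trans (leOfHom f)) :=
  rfl

theorem innerEval_map (G : Cᵒᵖ ⥤ ModuleCat.{0} ℂ) {W : Opens Z} {c d : C}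
    (h : closure (u.obj c : Set Z) ⊆ W) (f : d ⟶ c) :
    innerEval G h ≫ G.map f.op = innerEval G ((closure_mono (leOfHom (u.map f))).trans h) := by
  ext s
  exact s.2 ⟨c, _⟩ ⟨d, _⟩ f

/-- The morphism to `innerSections` determined by a compatible family of morphisms. -/
def innerLift {F : (Opens Z)ᵒᵖ ⥤ ModuleCat.{0} ℂ} {G : Cᵒᵖ ⥤ ModuleCat.{0} ℂ}
    (φ : ∀ (c : C) (W : Opens Z), closure (u.obj c : Set Z) ⊆ W → (F.obj (op W) ⟶ G.obj (op c)))
    (h₁ : ∀ (c : C) (W W' : Opens Z) (hW : closure (u.obj c : Set Z) ⊆ W) (f : W ⟶ W'),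
      F.map f.op ≫ φ c W hW = φ c W' (hW.trans (leOfHom f)))
    (h₂ : ∀ (c d : C) (W : Opens Z) (hW : closure (u.obj c : Set Z) ⊆ W) (f : d ⟶ c),
      φ c W hW ≫ G.map f.op = φ d W ((closure_mono (leOfHom (u.map f))).trans hW)) :
    F ⟶ (innerSections u).obj G where
  app W := ModuleCat.ofHom
    { toFun := fun s => ⟨fun c => φ c.1 W.unop c.2 s, fun c d f =>
        ConcreteCategory.congr_hom (h₂ c.1 d.1 W.unop c.2 f) s⟩
      map_add' := fun _ _ => Subtype.ext (funext fun _ => map_add _ _ _)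
      map_smul' := fun _ _ => Subtype.ext (funext fun _ => map_smul _ _ _) }
  naturality W W' f := innerSections_hom_ext fun c hc => h₁ c W'.unop W.unop hc f.unop

@[simp]
theorem innerLift_eval {F : (Opens Z)ᵒᵖ ⥤ ModuleCat.{0} ℂ} {G : Cᵒᵖ ⥤ ModuleCat.{0} ℂ}
    (φ : ∀ (c : C) (W : Opens Z), closure (u.obj c : Set Z) ⊆ W → (F.obj (op W) ⟶ G.obj (op c)))
    (h₁ h₂) {c : C} {W : Opens Z} (hW : closure (u.obj c : Set Z) ⊆ W) :
    (innerLift φ h₁ h₂).app (op W) ≫ innerEval G hW = φ c W hW :=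
  rfl

variable (u) in
/-- `closureExt` is left adjoint to `innerSections`. -/
def closureExtAdjunction : closureExt u ⊣ innerSections u :=
  Adjunction.mkOfHomEquiv
    { homEquiv := fun F G =>
        { toFun := fun ψ => innerLift (fun c W h => germ u F h ≫ ψ.app (op c))
            (fun c W W' hW f => by rw [reassoc_of% (@map_germ)])
            (fun c d W hW f => by rw [Category.assoc, ← ψ.naturality, reassoc_of% (@germ_map)])
          invFun := fun ψ => closureExtDesc (fun c W h => ψ.app (op W) ≫ innerEval G h)
            (fun c W W' hW f => by rw [ψ.naturality_assoc, map_innerEval])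
            (fun c d W hW f => by rw [Category.assoc, innerEval_map])
          left_inv := fun ψ => closureExt_natTrans_ext fun c W hW => by simp
          right_inv := fun ψ => NatTrans.ext <| funext fun W =>
            innerSections_hom_ext (W := W.unop) fun c hc =>
              germ_closureExtDesc (fun c W h => ψ.app (op W) ≫ innerEval G h)
                (fun c W W' hW f => by rw [ψ.naturality_assoc, map_innerEval])
                (fun c d W hW f => by rw [Category.assoc, innerEval_map]) hc }
      homEquiv_naturality_left_symm := fun f g => closureExt_natTrans_ext fun c W hW => by
        simp [reassoc_of% (@germ_naturality)]
      homEquiv_naturality_right := fun f g => NatTrans.ext <| funext fun W =>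
        innerSections_hom_ext (W := W.unop) fun c hc =>
          (Category.assoc (germ u _ hc) (f.app (op c)) (g.app (op c))).symm }

end InnerSections

/-! ### Inner bases: compatible families of sections form sheaves and recover sheaves -/

section InnerSheaf

variable {Z C : Type} [TopologicalSpace Z] [Preorder C]

/-- The site `(C, J)` of open subsets of `Z` has enough objects with small closure: every point
has a neighbourhood basis of closures of objects, and an open covering of the closure of an object
has a refinement by closures of objects which form a covering in `(C, J)`. -/
structure IsInnerBasis (u : C ⥤ Opens Z) (J : GrothendieckTopology C) : Prop where
  le_of_obj_le : ∀ {c d : C}, u.obj d ≤ u.obj c → d ≤ c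
  exists_mem : ∀ {W : Opens Z} {z : Z}, z ∈ W →
    ∃ c : C, z ∈ u.obj c ∧ closure (u.obj c : Set Z) ⊆ W
  exists_cover : ∀ (c : C) (𝒲 : Set (Opens Z)),
    (∀ z ∈ closure (u.obj c : Set Z), ∃ W ∈ 𝒲, z ∈ W) →
    ∃ T ∈ J c, ∀ (d : C) (f : d ⟶ c), T.arrows f → ∃ W ∈ 𝒲, closure (u.obj d : Set Z) ⊆ W

variable {u : C ⥤ Opens Z} {J : GrothendieckTopology C}

/-- An open covering of `W` covers the closure of every `u c` contained in `W`, so `c` has a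
`J`-covering by objects whose closures lie in single members. Separatedness and gluing then reduce
to those of `G` at each `c`. -/
theorem IsInnerBasis.isSheaf (hu : IsInnerBasis u J) {G : Cᵒᵖ ⥤ ModuleCat.{0} ℂ}
    (hG : Presheaf.IsSheaf J G) :
    Presheaf.IsSheaf (Opens.grothendieckTopology Z) ((innerSections u).obj G) := by
  have cov : ∀ {W : Opens Z} (T : Sieve W), T ∈ Opens.grothendieckTopology Z W → ∀ (c : C),
      closure (u.obj c : Set Z) ⊆ W → ∃ R ∈ J c, ∀ (d : C) (f : d ⟶ c), R.arrows f →
        ∃ (V : Opens Z) (i : V ⟶ W), T i ∧ closure (u.obj d : Set Z) ⊆ V := by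
    intro W T hT c hc
    obtain ⟨R, hR, h⟩ := hu.exists_cover c {V | ∃ i : V ⟶ W, T i} fun z hz => by
      obtain ⟨V, i, hi, hzV⟩ := hT z (hc hz)
      exact ⟨V, ⟨i, hi⟩, hzV⟩
    refine ⟨R, hR, fun d f hf => ?_⟩
    obtain ⟨V, ⟨i, hi⟩, hV⟩ := h d f hf
    exact ⟨V, i, hi, hV⟩
  refine isSheaf_of_restrict ?_ ?_
  · intro W T hT s t hst
    refine innerSections_ext fun c hc => ?_
    obtain ⟨R, hR, h⟩ := cov T hT c hc
    refine eq_of_restrict_eq hG hR fun d f hf => ?_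
    obtain ⟨V, i, hi, hV⟩ := h d f hf
    have key := congrArg (innerEval G hV) (hst V i hi)
    have e := fun x => ConcreteCategory.congr_hom (innerEval_map G hc f) x
    exact (e s).trans (key.trans (e t).symm)
  · intro W T hT x hx
    -- The value at `d` does not depend on the member of the covering used to compute it: compare
    -- both through `V ⊓ V'`.
    have loc : ∀ (d : C) (V V' : Opens Z) (i : V ⟶ W) (hi : T i) (i' : V' ⟶ W) (hi' : T i')
        (hV : closure (u.obj d : Set Z) ⊆ V) (hV' : closure (u.obj d : Set Z) ⊆ V'),
        innerEval G hV (x V i hi) = innerEval G hV' (x V' i' hi') := by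
      intro d V V' i hi i' hi' hV hV'
      have hVV : closure (u.obj d : Set Z) ⊆ (V ⊓ V' : Opens Z) := Set.subset_inter hV hV'
      have e := congrArg (innerEval G hVV) (hx V (V ⊓ V') i hi (homOfLE inf_le_left))
      have e' := congrArg (innerEval G hVV) (hx V' (V ⊓ V') i' hi' (homOfLE inf_le_right))
      exact e.trans e'.symm
    have glue : ∀ c : {c : C // closure (u.obj c : Set Z) ⊆ W}, ∃ t : G.obj (op c.1),
        ∀ (d : C) (f : d ⟶ c.1) (V : Opens Z) (i : V ⟶ W) (hi : T i)
          (hV : closure (u.obj d : Set Z) ⊆ V), G.map f.op t = innerEval G hV (x V i hi) := by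
      rintro ⟨c, hc⟩
      obtain ⟨R, hR, h⟩ := cov T hT c hc
      choose V i hi hV using h
      obtain ⟨t, ht⟩ := exists_restrict_eq hG hR
        (fun d f hf => innerEval G (hV d f hf) (x (V d f hf) (i d f hf) (hi d f hf)))
        fun d e f hf g => by
          refine (ConcreteCategory.congr_hom (innerEval_map G (hV d f hf) g) _).trans ?_
          exact loc _ _ _ _ _ _ _ _ _
      -- The glued `t` is only known on `R`. Pulling `R` back to an arbitrary `d` extends the
      -- formula to every `d` with closure in a member of `T`.
      refine ⟨t, fun d f V' i' hi' hV' => eq_of_restrict_eq hG (J.pullback_stable f hR) ?_⟩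
      intro e g hg
      rw [← ConcreteCategory.comp_apply, ← G.map_comp]
      refine (ht e (g ≫ f) hg).trans ?_
      refine Eq.trans ?_ (ConcreteCategory.congr_hom (innerEval_map G hV' g) _).symm
      exact loc _ _ _ _ _ _ _ _ _
    choose t ht using glue
    refine ⟨⟨t, fun c d f => ?_⟩, fun V i hi => innerSections_ext fun c hc => ?_⟩
    · obtain ⟨R, hR, h⟩ := cov T hT d.1 d.2
      refine eq_of_restrict_eq hG hR fun e g hg => ?_
      obtain ⟨V, i, hi, hV⟩ := h e g hg
      rw [← ConcreteCategory.comp_apply, ← G.map_comp]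
      exact (ht c e (g ≫ f) V i hi hV).trans (ht d e g V i hi hV).symm
    · have := ht ⟨c, hc.trans (leOfHom i)⟩ c (𝟙 c) V i hi hc
      rw [op_id, G.map_id] at this
      exact this

/-- The canonical morphism from a presheaf on `Z` to the compatible families of its sections. -/
def toInnerSections (u : C ⥤ Opens Z) (H : (Opens Z)ᵒᵖ ⥤ ModuleCat.{0} ℂ) :
    H ⟶ (innerSections u).obj (u.op ⋙ H) :=
  innerLift (fun _ _ h => H.map (closureSubsetHom h).op)
    (fun _ _ _ _ _ => (H.map_comp _ _).symm) (fun _ _ _ _ _ => (H.map_comp _ _).symm)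

theorem toInnerSections_naturality {H H' : (Opens Z)ᵒᵖ ⥤ ModuleCat.{0} ℂ} (φ : H ⟶ H') :
    φ ≫ toInnerSections u H' =
      toInnerSections u H ≫ (innerSections u).map (Functor.whiskerLeft u.op φ) :=
  NatTrans.ext <| funext fun W => innerSections_hom_ext (W := W.unop) fun _ hc =>
    (φ.naturality (closureSubsetHom hc).op).symm

/-- The sets `u c` with closure in `W` cover `W`, so a section over `W` is determined by its
restrictions to them. Conversely a compatible family glues, since its members agree on every `u d`
with small closure inside an overlap. -/
theorem IsInnerBasis.isIso_toInnerSections (hu : IsInnerBasis u J)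
    {H : (Opens Z)ᵒᵖ ⥤ ModuleCat.{0} ℂ}
    (hH : Presheaf.IsSheaf (Opens.grothendieckTopology Z) H) : IsIso (toInnerSections u H) := by
  have hsep : ∀ (W : Opens Z) (s t : H.obj (op W)),
      (∀ (c : C) (hc : closure (u.obj c : Set Z) ⊆ W),
        H.map (closureSubsetHom hc).op s = H.map (closureSubsetHom hc).op t) → s = t := by
    intro W s t h
    let T : Sieve W :=
      { arrows := fun V _ => ∃ c : C, V ≤ u.obj c ∧ closure (u.obj c : Set Z) ⊆ W
        downward_closed := fun {V V'} _ ⟨c, h1, h2⟩ g => ⟨c, (leOfHom g).trans h1, h2⟩ }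
    refine eq_of_restrict_eq hH (T := T) ?_ ?_
    · intro z hz
      obtain ⟨c, hzc, hc⟩ := hu.exists_mem hz
      exact ⟨u.obj c, closureSubsetHom hc, ⟨c, le_rfl, hc⟩, hzc⟩
    · rintro V f ⟨c, hVc, hc⟩
      have e : f.op = (closureSubsetHom hc).op ≫ (homOfLE hVc).op := Subsingleton.elim _ _
      rw [e, H.map_comp, ConcreteCategory.comp_apply, h c hc, ConcreteCategory.comp_apply]
  have : ∀ W, IsIso ((toInnerSections u H).app W) := by
    intro W
    rw [ConcreteCategory.isIso_iff_bijective]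
    constructor
    · intro s t hst
      exact hsep W.unop s t fun c hc => congrArg (innerEval _ hc) hst
    · intro s
      let T : Sieve W.unop :=
        { arrows := fun V _ => ∃ c : C, V ≤ u.obj c ∧ closure (u.obj c : Set Z) ⊆ W.unop
          downward_closed := fun {V V'} _ ⟨c, h1, h2⟩ g => ⟨c, (leOfHom g).trans h1, h2⟩ }
      have hT : T ∈ Opens.grothendieckTopology Z W.unop := by
        intro z hz
        obtain ⟨c, hzc, hc⟩ := hu.exists_mem hz
        exact ⟨u.obj c, closureSubsetHom hc, ⟨c, le_rfl, hc⟩, hzc⟩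
      have loc : ∀ (V : Opens Z) (c c' : C) (h : V ≤ u.obj c) (h' : V ≤ u.obj c')
          (hc : closure (u.obj c : Set Z) ⊆ W.unop) (hc' : closure (u.obj c' : Set Z) ⊆ W.unop),
          H.map (homOfLE h).op (innerEval (u.op ⋙ H) hc s) =
            H.map (homOfLE h').op (innerEval (u.op ⋙ H) hc' s) := by
        intro V c c' h h' hc hc'
        -- As `u d` lies in both `u c` and `u c'`, compatibility identifies both restrictions with
        -- the component of `s` at `d`.
        refine hsep V _ _ fun d hd => ?_
        have hdV : u.obj d ≤ V := leOfHom (closureSubsetHom hd)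
        have e : ∀ (c : C) (h : V ≤ u.obj c) (hc : closure (u.obj c : Set Z) ⊆ W.unop),
            H.map (closureSubsetHom hd).op (H.map (homOfLE h).op (innerEval (u.op ⋙ H) hc s)) =
              innerEval (u.op ⋙ H) (hd.trans (h.trans (subset_closure.trans hc))) s := by
          intro c h hc
          rw [← ConcreteCategory.comp_apply, ← H.map_comp]
          exact ConcreteCategory.congr_hom
            (innerEval_map (u.op ⋙ H) hc (homOfLE (hu.le_of_obj_le (hdV.trans h)))) s
        rw [e c, e c']
      obtain ⟨t, ht⟩ := exists_restrict_eq hH hT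
        (fun V f hf => H.map (homOfLE hf.choose_spec.1).op
          (innerEval (u.op ⋙ H) hf.choose_spec.2 s))
        fun V V' f hf g => by
          rw [← ConcreteCategory.comp_apply, ← H.map_comp]
          exact loc _ _ _ _ _ _ _
      refine ⟨t, innerSections_ext fun c hc => ?_⟩
      -- The gluing data used an arbitrarily chosen object containing `u c`; `loc` replaces it by
      -- `c` itself.
      have hf : T (closureSubsetHom hc) := ⟨c, le_rfl, hc⟩
      refine (ht _ _ hf).trans ?_
      refine (loc _ _ c _ le_rfl _ hc).trans ?_
      exact ConcreteCategory.congr_hom (H.map_id _) _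
  exact NatIso.isIso_of_isIso_app _

/-- The canonical morphism from a presheaf on `C` to its compatible families. -/
def IsInnerBasis.toRestrict (hu : IsInnerBasis u J) (G : Cᵒᵖ ⥤ ModuleCat.{0} ℂ) :
    G ⟶ u.op ⋙ (innerSections u).obj G where
  app c := ModuleCat.ofHom
    { toFun := fun s => ⟨fun d => G.map (homOfLE (hu.le_of_obj_le (c := c.unop)
          (leOfHom (closureSubsetHom d.2)))).op s, fun d e f => by
        dsimp only
        rw [← ConcreteCategory.comp_apply, ← G.map_comp]
        rfl⟩
      map_add' := fun _ _ => Subtype.ext (funext fun _ => map_add _ _ _)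
      map_smul' := fun _ _ => Subtype.ext (funext fun _ => map_smul _ _ _) }
  naturality c d f := innerSections_hom_ext (W := u.obj d.unop) fun e he => by
    ext s
    change G.map _ (G.map _ s) = G.map _ s
    rw [← ConcreteCategory.comp_apply, ← G.map_comp]
    rfl

end InnerSheaf

/-! ### The left adjoint of the inverse image, through compatible families -/

section Shriek

variable {Z C : Type} [TopologicalSpace Z] [Preorder C] {u : C ⥤ Opens Z}
  {J : GrothendieckTopology C}

/-- The functor `innerSections` on sheaves. -/
def IsInnerBasis.innerSheaf (hu : IsInnerBasis u J) : Sheaf J (ModuleCat.{0} ℂ) ⥤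
    Sheaf (Opens.grothendieckTopology Z) (ModuleCat.{0} ℂ) where
  obj G := ⟨(innerSections u).obj G.obj, hu.isSheaf G.property⟩
  map φ := ⟨(innerSections u).map φ.hom⟩

variable (u J) in
/-- The functor which sends `A` to the sheaf on `(C, J)` associated to `closureExt A`. -/
def shriek : Sheaf (Opens.grothendieckTopology Z) (ModuleCat.{0} ℂ) ⥤
    Sheaf J (ModuleCat.{0} ℂ) :=
  sheafToPresheaf _ _ ⋙ closureExt u ⋙ presheafToSheaf J _

instance : PreservesFiniteLimits (shriek u J) := by
  have : PreservesFiniteLimits (closureExt u ⋙ presheafToSheaf J (ModuleCat.{0} ℂ)) :=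
    comp_preservesFiniteLimits _ _
  exact comp_preservesFiniteLimits _ _

/-- The morphism from `closureExt A` to its associated sheaf. -/
def toShriek (A : Sheaf (Opens.grothendieckTopology Z) (ModuleCat.{0} ℂ)) :
    (closureExt u).obj A.obj ⟶ ((shriek u J).obj A).obj :=
  toSheafify J ((closureExt u).obj A.obj)

theorem toShriek_naturality {A B : Sheaf (Opens.grothendieckTopology Z) (ModuleCat.{0} ℂ)}
    (f : A ⟶ B) : toShriek A ≫ ((shriek u J).map f).hom =
      (closureExt u).map f.hom ≫ toShriek B :=
  (toSheafify_naturality J ((closureExt u).map f.hom)).symm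

theorem W_toShriek (A : Sheaf (Opens.grothendieckTopology Z) (ModuleCat.{0} ℂ)) :
    J.W (toShriek (u := u) (J := J) A) :=
  J.W_toSheafify _

/-- The functor `shriek` is left adjoint to `innerSheaf`. -/
def IsInnerBasis.shriekInnerAdjunction (hu : IsInnerBasis u J) : shriek u J ⊣ hu.innerSheaf :=
  Adjunction.mkOfHomEquiv
    { homEquiv := fun A G =>
        ((sheafificationAdjunction J (ModuleCat.{0} ℂ)).homEquiv ((closureExt u).obj A.obj) G).trans
          (((closureExtAdjunction u).homEquiv A.obj G.obj).trans
            ((fullyFaithfulSheafToPresheaf (Opens.grothendieckTopology Z) (ModuleCat.{0} ℂ)).homEquiv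
              (X := A) (Y := hu.innerSheaf.obj G)).symm)
      homEquiv_naturality_left_symm := fun {_ _ G} f g =>
        (congrArg ((sheafificationAdjunction J (ModuleCat.{0} ℂ)).homEquiv _ G).symm
          ((closureExtAdjunction u).homEquiv_naturality_left_symm f.hom g.hom)).trans
          ((sheafificationAdjunction J (ModuleCat.{0} ℂ)).homEquiv_naturality_left_symm _ _)
      homEquiv_naturality_right := fun {A _ G'} f g => Sheaf.hom_ext <|
        (congrArg ((closureExtAdjunction u).homEquiv A.obj G'.obj)
          ((sheafificationAdjunction J (ModuleCat.{0} ℂ)).homEquiv_naturality_right f g)).trans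
          ((closureExtAdjunction u).homEquiv_naturality_right _ _) }

/-- This makes the unit explicit: a section over `W` goes to the family of its germs along the
closures of the `u c`, read in the associated sheaf. -/
theorem IsInnerBasis.shriekInnerAdjunction_unit_eval (hu : IsInnerBasis u J)
    (A : Sheaf (Opens.grothendieckTopology Z) (ModuleCat.{0} ℂ)) {c : C} {W : Opens Z}
    (hW : closure (u.obj c : Set Z) ⊆ W) :
    (hu.shriekInnerAdjunction.unit.app A).hom.app (op W) ≫ innerEval _ hW =
      germ u A.obj hW ≫ (toShriek A).app (op c) := by
  have h : (sheafificationAdjunction J (ModuleCat.{0} ℂ)).homEquiv ((closureExt u).obj A.obj)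
      ((shriek u J).obj A) (𝟙 _) = toShriek A :=
    (sheafificationAdjunction J (ModuleCat.{0} ℂ)).homEquiv_id _
  rw [← h]
  rfl

/-- The canonical isomorphism from a sheaf to the compatible families of its sections. -/
def IsInnerBasis.innerIso (hu : IsInnerBasis u J)
    [u.IsContinuous J (Opens.grothendieckTopology Z)] :
    𝟭 (Sheaf (Opens.grothendieckTopology Z) (ModuleCat.{0} ℂ)) ≅
      u.sheafPushforwardContinuous (ModuleCat.{0} ℂ) J (Opens.grothendieckTopology Z) ⋙
        hu.innerSheaf :=
  NatIso.ofComponents (fun H =>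
    (fullyFaithfulSheafToPresheaf _ _).preimageIso
      (@asIso _ _ _ _ (toInnerSections u H.obj) (hu.isIso_toInnerSections H.property)))
    fun f => Sheaf.hom_ext (toInnerSections_naturality f.hom)

/-- `innerSheaf` is left adjoint to the direct image. -/
def IsInnerBasis.innerAdjunction (hu : IsInnerBasis u J)
    [u.IsContinuous J (Opens.grothendieckTopology Z)] :
    hu.innerSheaf ⊣
      u.sheafPushforwardContinuous (ModuleCat.{0} ℂ) J (Opens.grothendieckTopology Z) where
  unit :=
    { app := fun G => ⟨hu.toRestrict G.obj⟩
      naturality := fun G G' f => Sheaf.hom_ext <| NatTrans.ext <| funext fun c =>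
        innerSections_hom_ext (W := u.obj c.unop) fun d hd =>
          (f.hom.naturality (homOfLE (hu.le_of_obj_le (c := c.unop)
            (leOfHom (closureSubsetHom hd)))).op).symm }
  counit := hu.innerIso.inv
  -- The counit is known only as an inverse, so the triangle is composed with `innerIso`. What
  -- remains compares, for closures nested as `d` in `c` in `W`, the component at `d` with the
  -- restriction of the component at `c`.
  left_triangle_components G := by
    rw [← cancel_mono (hu.innerIso.hom.app _), Category.assoc]
    refine (congrArg _ (hu.innerIso.inv_hom_id_app _)).trans ?_
    refine (Category.comp_id _).trans (Eq.trans ?_ (Category.id_comp _).symm)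
    refine Sheaf.hom_ext <| NatTrans.ext <| funext fun W =>
      innerSections_hom_ext (W := W.unop) fun c hc => ?_
    refine innerSections_hom_ext (W := u.obj c) fun d hd => ?_
    exact innerEval_map G.obj hc (homOfLE (hu.le_of_obj_le (leOfHom (closureSubsetHom hd))))
  right_triangle_components H := by
    -- The direct image of `innerIso` is the unit at the direct image of `H`, as both have the
    -- restriction maps of `H` as components. The triangle is therefore `innerIso` composed with its
    -- inverse.
    have e : (u.sheafPushforwardContinuous (ModuleCat.{0} ℂ) J (Opens.grothendieckTopology Z)).map
        (hu.innerIso.hom.app H) = ⟨hu.toRestrict (u.op ⋙ H.obj)⟩ :=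
      Sheaf.hom_ext <| NatTrans.ext <| funext fun c =>
        innerSections_hom_ext (W := u.obj c.unop) fun d hd => rfl
    have e' := ((u.sheafPushforwardContinuous (ModuleCat.{0} ℂ) J
      (Opens.grothendieckTopology Z)).mapIso (hu.innerIso.app H)).hom_inv_id
    dsimp only [Functor.mapIso_hom, Iso.app_hom] at e'
    rw [e] at e'
    exact e'

end Shriek

/-! ### Tensor products of sheaves through local isomorphisms -/

section SheafTensor

variable {C : Type} [SmallCategory C] {J : GrothendieckTopology C}

theorem toSheafTensor_naturality {A A' B B' : Sheaf J (ModuleCat.{0} ℂ)} (f : A ⟶ A')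
    (g : B ⟶ B') :
    (f.hom ⊗ₘ g.hom) ≫ toSheafTensor J A' B' = toSheafTensor J A B ≫ (f ⊗ₘ g).hom :=
  letI := (sheafificationAdjunction J (ModuleCat.{0} ℂ)).rightAdjointLaxMonoidal
  Functor.LaxMonoidal.μ_natural (sheafToPresheaf J (ModuleCat.{0} ℂ)) f g

/-- The map is a sheafification unit followed by isomorphisms, because sheafification is monoidal
and its counit at a sheaf is invertible. Morphisms out of `A ⊗ B` can thus be tested on the presheaf
tensor product. -/
theorem W_toSheafTensor (A B : Sheaf J (ModuleCat.{0} ℂ)) : J.W (toSheafTensor J A B) := by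
  let adj := sheafificationAdjunction J (ModuleCat.{0} ℂ)
  have h : toSheafTensor J A B = adj.unit.app (A.obj ⊗ B.obj) ≫
      (sheafToPresheaf J (ModuleCat.{0} ℂ)).map
        (Functor.OplaxMonoidal.δ (presheafToSheaf J (ModuleCat.{0} ℂ)) A.obj B.obj ≫
          (adj.counit.app A ⊗ₘ adj.counit.app B)) := rfl
  rw [h]
  refine MorphismProperty.comp_mem _ _ _ (J.W_adj_unit_app adj _) ?_
  rw [GrothendieckTopology.W_sheafToPresheaf_map_iff_isIso]
  infer_instance

theorem hom_ext_of_W {P : Cᵒᵖ ⥤ ModuleCat.{0} ℂ} {G G' : Sheaf J (ModuleCat.{0} ℂ)}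
    {s : P ⟶ G.obj} (hs : J.W s) {f g : G ⟶ G'} (h : s ≫ f.hom = s ≫ g.hom) : f = g :=
  Sheaf.hom_ext ((hs G'.obj G'.property).1 h)

/-- Two sheaves associated to the same presheaf are isomorphic. -/
def isoOfW {P : Cᵒᵖ ⥤ ModuleCat.{0} ℂ} {G G' : Sheaf J (ModuleCat.{0} ℂ)} {s : P ⟶ G.obj}
    {s' : P ⟶ G'.obj} (hs : J.W s) (hs' : J.W s') : G ≅ G' where
  hom := ⟨((hs G'.obj G'.property).2 s').choose⟩
  inv := ⟨((hs' G.obj G.property).2 s).choose⟩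
  hom_inv_id := hom_ext_of_W hs <| by
    have h₁ := ((hs G'.obj G'.property).2 s').choose_spec
    have h₂ := ((hs' G.obj G.property).2 s).choose_spec
    dsimp at h₁ h₂ ⊢
    rw [reassoc_of% h₁, h₂, Category.comp_id]
  inv_hom_id := hom_ext_of_W hs' <| by
    have h₁ := ((hs G'.obj G'.property).2 s').choose_spec
    have h₂ := ((hs' G.obj G.property).2 s).choose_spec
    dsimp at h₁ h₂ ⊢
    rw [reassoc_of% h₂, h₁, Category.comp_id]

theorem isoOfW_hom {P : Cᵒᵖ ⥤ ModuleCat.{0} ℂ} {G G' : Sheaf J (ModuleCat.{0} ℂ)} {s : P ⟶ G.obj}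
    {s' : P ⟶ G'.obj} (hs : J.W s) (hs' : J.W s') : s ≫ (isoOfW hs hs').hom.hom = s' :=
  ((hs G'.obj G'.property).2 s').choose_spec

/-- Two commuting squares are tensored, then moved through `μ` by naturality. This is the formal
step shared by the naturality of `pullbackTensor` and the comparison with coreflections. -/
theorem tensorHom_comp_μ_comp_map {P Q : Type*} [Category* P] [Category* Q] [MonoidalCategory P]
    [MonoidalCategory Q] (R : Q ⥤ P) [R.LaxMonoidal] {a a' b b' : P} {x x' y y' t t' : Q}
    {f : a ⟶ a'} {g : b ⟶ b'} {α : a ⟶ R.obj x} {α' : a' ⟶ R.obj x'} {β : b ⟶ R.obj y}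
    {β' : b' ⟶ R.obj y'} {φ : x ⟶ x'} {ψ : y ⟶ y'} {τ : x ⊗ y ⟶ t} {τ' : x' ⊗ y' ⟶ t'}
    {χ : t ⟶ t'} (hf : f ≫ α' = α ≫ R.map φ) (hg : g ≫ β' = β ≫ R.map ψ)
    (hτ : (φ ⊗ₘ ψ) ≫ τ' = τ ≫ χ) :
    (f ⊗ₘ g) ≫ (α' ⊗ₘ β') ≫ Functor.LaxMonoidal.μ R x' y' ≫ R.map τ' =
      ((α ⊗ₘ β) ≫ Functor.LaxMonoidal.μ R x y ≫ R.map τ) ≫ R.map χ := by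
  rw [tensorHom_comp_tensorHom_assoc, hf, hg, ← tensorHom_comp_tensorHom_assoc,
    Functor.LaxMonoidal.μ_natural_assoc, ← R.map_comp, hτ, R.map_comp]
  simp only [Category.assoc]

variable {D : Type} [SmallCategory D]

theorem toSheafTensor_homEquiv_pullbackTensor (u : C ⥤ D) (J : GrothendieckTopology C)
    (K : GrothendieckTopology D) [u.IsContinuous J K] (A B : Sheaf J (ModuleCat.{0} ℂ)) :
    toSheafTensor J A B ≫ ((u.sheafAdjunctionContinuous (ModuleCat.{0} ℂ) J K).homEquiv _ _
      (pullbackTensor u J K A B)).hom =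
      (((u.sheafAdjunctionContinuous (ModuleCat.{0} ℂ) J K).unit.app A).hom ⊗ₘ
        ((u.sheafAdjunctionContinuous (ModuleCat.{0} ℂ) J K).unit.app B).hom) ≫
      Functor.LaxMonoidal.μ ((Functor.whiskeringLeft _ _ (ModuleCat.{0} ℂ)).obj u.op) _ _ ≫
      ((Functor.whiskeringLeft _ _ (ModuleCat.{0} ℂ)).obj u.op).map (toSheafTensor K _ _) := by
  dsimp only [pullbackTensor]
  rw [Equiv.apply_symm_apply]
  exact toSheafTensor_sheafTensorLift _

/-- After transposing along `u⁻¹ ⊣ u_*` and testing on the presheaf tensor product, only the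
naturality of the unit and of `toSheafTensor` is left. -/
theorem pullbackTensor_naturality (u : C ⥤ D) (J : GrothendieckTopology C)
    (K : GrothendieckTopology D) [u.IsContinuous J K] {A A' B B' : Sheaf J (ModuleCat.{0} ℂ)}
    (f : A ⟶ A') (g : B ⟶ B') :
    (u.sheafPullback (ModuleCat.{0} ℂ) J K).map (f ⊗ₘ g) ≫ pullbackTensor u J K A' B' =
      pullbackTensor u J K A B ≫ ((u.sheafPullback (ModuleCat.{0} ℂ) J K).map f ⊗ₘ
        (u.sheafPullback (ModuleCat.{0} ℂ) J K).map g) := by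
  let adj := u.sheafAdjunctionContinuous (ModuleCat.{0} ℂ) J K
  let R := (Functor.whiskeringLeft _ _ (ModuleCat.{0} ℂ)).obj u.op
  apply (adj.homEquiv _ _).injective
  rw [adj.homEquiv_naturality_left, adj.homEquiv_naturality_right]
  apply hom_ext_of_W (W_toSheafTensor A B)
  have e : ∀ {A A' : Sheaf J (ModuleCat.{0} ℂ)} (f : A ⟶ A'), f.hom ≫ (adj.unit.app A').hom =
      (adj.unit.app A).hom ≫ R.map ((u.sheafPullback (ModuleCat.{0} ℂ) J K).map f).hom :=
    fun f => congrArg (fun t => t.hom) (adj.unit.naturality f)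
  have h : ∀ A B : Sheaf J (ModuleCat.{0} ℂ), toSheafTensor J A B ≫
      (adj.homEquiv _ _ (pullbackTensor u J K A B)).hom =
        ((adj.unit.app A).hom ⊗ₘ (adj.unit.app B).hom) ≫ Functor.LaxMonoidal.μ R _ _ ≫
          R.map (toSheafTensor K _ _) := toSheafTensor_homEquiv_pullbackTensor u J K
  have key : (f.hom ⊗ₘ g.hom) ≫ toSheafTensor J A' B' ≫
        (adj.homEquiv _ _ (pullbackTensor u J K A' B')).hom =
      (toSheafTensor J A B ≫ (adj.homEquiv _ _ (pullbackTensor u J K A B)).hom) ≫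
        R.map ((u.sheafPullback (ModuleCat.{0} ℂ) J K).map f ⊗ₘ
          (u.sheafPullback (ModuleCat.{0} ℂ) J K).map g).hom := by
    rw [h, h]
    exact tensorHom_comp_μ_comp_map R (e f) (e g) (toSheafTensor_naturality _ _)
  refine Eq.trans ?_ (key.trans (Category.assoc _ _ _))
  exact (Category.assoc _ _ _).symm.trans
    ((congrArg (· ≫ (adj.homEquiv _ _ (pullbackTensor u J K A' B')).hom)
      (toSheafTensor_naturality f g)).symm.trans (Category.assoc _ _ _))

end SheafTensor

/-! ### The left adjoint commutes with tensor products -/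

section Shriek

variable {Z C : Type} [TopologicalSpace Z] [Preorder C] {u : C ⥤ Opens Z}
  {J : GrothendieckTopology C}

/-- The right adjoint `innerSections` takes sheaves to sheaves, so by adjunction its left adjoint
preserves the morphisms inverted by sheafification. -/
theorem IsInnerBasis.W_closureExt_map (hu : IsInnerBasis u J)
    {F F' : (Opens Z)ᵒᵖ ⥤ ModuleCat.{0} ℂ} {f : F ⟶ F'}
    (hf : (Opens.grothendieckTopology Z).W f) : J.W ((closureExt u).map f) := by
  intro G hG
  have h := hf _ (hu.isSheaf hG)
  have e : (fun g : (closureExt u).obj F' ⟶ G => (closureExt u).map f ≫ g) =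
      ((closureExtAdjunction u).homEquiv F G).symm ∘ (fun g => f ≫ g) ∘
        ((closureExtAdjunction u).homEquiv F' G) := by
    funext g
    dsimp only [Function.comp_apply]
    rw [← Adjunction.homEquiv_naturality_left, Equiv.symm_apply_apply]
  change Function.Bijective (fun g : (closureExt u).obj F' ⟶ G => (closureExt u).map f ≫ g)
  rw [e]
  exact (Equiv.bijective _).comp (h.comp (Equiv.bijective _))

/-- The morphism `closureExt (A ⊗ B) ⟶ shriek (A ⊗ B)`. -/
def tensorToShriek (A B : Sheaf (Opens.grothendieckTopology Z) (ModuleCat.{0} ℂ)) :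
    (closureExt u).obj (A.obj ⊗ B.obj) ⟶ ((shriek u J).obj (A ⊗ B)).obj :=
  (closureExt u).map (toSheafTensor _ A B) ≫ toShriek (A ⊗ B)

/-- The morphism `closureExt (A ⊗ B) ⟶ shriek A ⊗ shriek B`. -/
def tensorToShriekTensor (A B : Sheaf (Opens.grothendieckTopology Z) (ModuleCat.{0} ℂ)) :
    (closureExt u).obj (A.obj ⊗ B.obj) ⟶ ((shriek u J).obj A ⊗ (shriek u J).obj B).obj :=
  closureExtTensor A.obj B.obj ≫ (toShriek A ⊗ₘ toShriek B) ≫ toSheafTensor J _ _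

theorem IsInnerBasis.W_tensorToShriek (hu : IsInnerBasis u J)
    (A B : Sheaf (Opens.grothendieckTopology Z) (ModuleCat.{0} ℂ)) :
    J.W (tensorToShriek (u := u) (J := J) A B) :=
  MorphismProperty.comp_mem _ _ _ (hu.W_closureExt_map (W_toSheafTensor A B)) (W_toShriek _)

/-- The first factor is an isomorphism, and local isomorphisms are stable under tensoring with a
presheaf. With `W_tensorToShriek` this presents both sheaves as sheafifications of the same
presheaf. -/
theorem W_tensorToShriekTensor (A B : Sheaf (Opens.grothendieckTopology Z) (ModuleCat.{0} ℂ)) :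
    J.W (tensorToShriekTensor (u := u) (J := J) A B) := by
  refine MorphismProperty.comp_mem _ _ _ (MorphismProperty.of_isIso _ _)
    (MorphismProperty.comp_mem _ _ _ ?_ (W_toSheafTensor _ _))
  rw [MonoidalCategory.tensorHom_def]
  exact MorphismProperty.comp_mem _ _ _ ((W_toShriek A).whiskerRight _)
    ((W_toShriek B).whiskerLeft _)

/-- The functor `shriek` commutes with tensor products. -/
def IsInnerBasis.shriekTensorIso (hu : IsInnerBasis u J) :
    tensor (Sheaf (Opens.grothendieckTopology Z) (ModuleCat.{0} ℂ)) ⋙ shriek u J ≅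
      (shriek u J).prod (shriek u J) ⋙ tensor (Sheaf J (ModuleCat.{0} ℂ)) :=
  NatIso.ofComponents
    (fun P => isoOfW (hu.W_tensorToShriek P.1 P.2) (W_tensorToShriekTensor P.1 P.2)) <| by
    rintro ⟨A, B⟩ ⟨A', B'⟩ ⟨f, g⟩
    apply hom_ext_of_W (hu.W_tensorToShriek A B)
    change tensorToShriek A B ≫ ((shriek u J).map (f ⊗ₘ g)).hom ≫ _ = tensorToShriek A B ≫
      (isoOfW (hu.W_tensorToShriek A B) (W_tensorToShriekTensor A B)).hom.hom ≫
        ((shriek u J).map f ⊗ₘ (shriek u J).map g).hom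
    have e₁ : tensorToShriek A B ≫ ((shriek u J).map (f ⊗ₘ g)).hom =
        (closureExt u).map (f.hom ⊗ₘ g.hom) ≫ tensorToShriek A' B' := by
      dsimp only [tensorToShriek]
      rw [Category.assoc, toShriek_naturality, ← Functor.map_comp_assoc, ← toSheafTensor_naturality,
        Functor.map_comp_assoc]
    have e₂ : tensorToShriekTensor A B ≫ ((shriek u J).map f ⊗ₘ (shriek u J).map g).hom =
        (closureExt u).map (f.hom ⊗ₘ g.hom) ≫ tensorToShriekTensor A' B' := by
      dsimp only [tensorToShriekTensor]
      rw [Category.assoc, Category.assoc, ← toSheafTensor_naturality,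
        tensorHom_comp_tensorHom_assoc, toShriek_naturality, toShriek_naturality,
        ← tensorHom_comp_tensorHom_assoc, ← Category.assoc, ← Category.assoc,
        ← closureExtTensor_naturality, Category.assoc, Category.assoc]
    rw [reassoc_of% (@isoOfW_hom), reassoc_of% e₁, e₂]
    congr 1
    exact isoOfW_hom _ _

theorem IsInnerBasis.shriekTensorIso_hom (hu : IsInnerBasis u J)
    (A B : Sheaf (Opens.grothendieckTopology Z) (ModuleCat.{0} ℂ)) :
    tensorToShriek A B ≫ (hu.shriekTensorIso.hom.app (A, B)).hom = tensorToShriekTensor A B :=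
  isoOfW_hom (hu.W_tensorToShriek A B) (W_tensorToShriekTensor A B)

end Shriek

theorem comp_assoc_five {P : Type*} [Category* P] {x₀ x₁ x₂ x₃ x₄ x₅ : P} (a : x₀ ⟶ x₁)
    (b : x₁ ⟶ x₂) (c : x₂ ⟶ x₃) (d : x₃ ⟶ x₄) (e : x₄ ⟶ x₅) :
    (a ≫ b ≫ c) ≫ d ≫ e = a ≫ b ≫ (c ≫ d) ≫ e := by
  simp only [Category.assoc]

theorem tensorHom_comp_tensorHom_comp_three {P : Type*} [Category* P] [MonoidalCategory P]
    {a a' a'' b b' b'' x y z : P} (f : a ⟶ a') (f' : a' ⟶ a'') (g : b ⟶ b') (g' : b' ⟶ b'')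
    (c : a'' ⊗ b'' ⟶ x) (d : x ⟶ y) (e : y ⟶ z) :
    (f ⊗ₘ g) ≫ ((f' ⊗ₘ g') ≫ c ≫ d) ≫ e = ((f ≫ f' ⊗ₘ g ≫ g') ≫ c ≫ d) ≫ e := by
  simp only [Category.assoc, ← tensorHom_comp_tensorHom]

/-! ### The unit of the adjunction and its inverse -/

section Shriek

variable {Z C : Type} [TopologicalSpace Z] [Preorder C] {u : C ⥤ Opens Z}
  {J : GrothendieckTopology C} [u.IsContinuous J (Opens.grothendieckTopology Z)]

/-- The morphism `shriek A ⟶ u_* A` induced by the restriction of sections from a neighbourhood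
of the closure of `u c` to `u c`. -/
def shriekRes (A : Sheaf (Opens.grothendieckTopology Z) (ModuleCat.{0} ℂ)) :
    (shriek u J).obj A ⟶ (u.sheafPushforwardContinuous (ModuleCat.{0} ℂ) J
      (Opens.grothendieckTopology Z)).obj A :=
  ⟨sheafifyLift J (closureExtRes A.obj) ((u.sheafPushforwardContinuous (ModuleCat.{0} ℂ) J
      (Opens.grothendieckTopology Z)).obj A).property⟩

theorem toShriek_shriekRes (A : Sheaf (Opens.grothendieckTopology Z) (ModuleCat.{0} ℂ)) :
    toShriek (u := u) (J := J) A ≫ (shriekRes A).hom = closureExtRes A.obj :=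
  toSheafify_sheafifyLift _ _ _

/-- On a germ along the closure of `u c`, both sides give the family of its germs along the closures
of those `u d` with closure inside `u c`. Transposed, this says that coreflection followed by the
unit is the identity. -/
theorem IsInnerBasis.shriekRes_comp_unit_inner (hu : IsInnerBasis u J)
    (A : Sheaf (Opens.grothendieckTopology Z) (ModuleCat.{0} ℂ)) :
    shriekRes A ≫ (u.sheafPushforwardContinuous (ModuleCat.{0} ℂ) J
      (Opens.grothendieckTopology Z)).map (hu.shriekInnerAdjunction.unit.app A) =
        hu.innerAdjunction.unit.app ((shriek u J).obj A) := by
  apply hom_ext_of_W (W_toShriek A)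
  change toShriek A ≫ (shriekRes A).hom ≫
    Functor.whiskerLeft u.op (hu.shriekInnerAdjunction.unit.app A).hom =
      toShriek A ≫ hu.toRestrict ((shriek u J).obj A).obj
  refine (Category.assoc _ _ _).symm.trans ((congrArg (· ≫ Functor.whiskerLeft u.op
    (hu.shriekInnerAdjunction.unit.app A).hom) (toShriek_shriekRes A)).trans ?_)
  refine closureExt_natTrans_ext fun c W hW => ?_
  refine innerSections_hom_ext (W := u.obj c) fun d hd => ?_
  have hdc : d ≤ c := hu.le_of_obj_le (leOfHom (closureSubsetHom hd))
  have e₁ : A.obj.map (closureSubsetHom hW).op ≫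
      (hu.shriekInnerAdjunction.unit.app A).hom.app (op (u.obj c)) ≫ innerEval _ hd =
        germ u A.obj (hd.trans (subset_closure.trans hW)) ≫ (toShriek A).app (op d) := by
    rw [hu.shriekInnerAdjunction_unit_eval, ← Category.assoc]
    exact congrArg (· ≫ (toShriek A).app (op d)) (map_germ A.obj hd (closureSubsetHom hW))
  have e₂ : germ u A.obj hW ≫ (toShriek A).app (op c) ≫
      ((shriek u J).obj A).obj.map (homOfLE hdc).op =
        germ u A.obj (hd.trans (subset_closure.trans hW)) ≫ (toShriek A).app (op d) := by
    rw [← (toShriek A).naturality, ← Category.assoc, germ_map]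
  refine Eq.trans ?_ (e₁.trans (e₂.symm.trans ?_))
  · exact congrArg (· ≫ (hu.shriekInnerAdjunction.unit.app A).hom.app (op (u.obj c)) ≫
      innerEval _ hd) (germ_closureExtRes A.obj hW)
  · rfl

/-- Taking the germ of a section along the closure of `u c` and restricting it to `u c` is plain
restriction. Since the counit inverts `innerIso`, this yields the other inverse relation. -/
theorem IsInnerBasis.unit_comp_inner_map_shriekRes (hu : IsInnerBasis u J)
    (A : Sheaf (Opens.grothendieckTopology Z) (ModuleCat.{0} ℂ)) :
    hu.shriekInnerAdjunction.unit.app A ≫ hu.innerSheaf.map (shriekRes A) =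
      hu.innerIso.hom.app A := by
  refine Sheaf.hom_ext <| NatTrans.ext <| funext fun W =>
    innerSections_hom_ext (W := W.unop) fun c hc => ?_
  have e := congrArg (· ≫ (shriekRes A).hom.app (op c)) (hu.shriekInnerAdjunction_unit_eval A hc)
  have e' := congrArg (germ u A.obj hc ≫ ·)
    (NatTrans.congr_app (toShriek_shriekRes (u := u) (J := J) A) (op c))
  exact e.trans (e'.trans (germ_closureExtRes A.obj hc))

/-- The functor `shriek` is left adjoint to the inverse image. -/
def IsInnerBasis.shriekAdjunction (hu : IsInnerBasis u J) :
    shriek u J ⊣ u.sheafPullback (ModuleCat.{0} ℂ) J (Opens.grothendieckTopology Z) :=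
  hu.shriekInnerAdjunction.ofNatIsoRight
    (hu.innerAdjunction.leftAdjointUniq (u.sheafAdjunctionContinuous _ _ _))

theorem IsInnerBasis.shriekAdjunction_unit (hu : IsInnerBasis u J)
    (A : Sheaf (Opens.grothendieckTopology Z) (ModuleCat.{0} ℂ)) :
    hu.shriekAdjunction.unit.app A = hu.shriekInnerAdjunction.unit.app A ≫
      (hu.innerAdjunction.leftAdjointUniq (u.sheafAdjunctionContinuous _ _ _)).hom.app _ := by
  simp [shriekAdjunction, Adjunction.ofNatIsoRight]

/-- The morphism `u⁻¹ (shriek A) ⟶ A`, inverse to the unit of the adjunction. -/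
def shriekCoreflection (A : Sheaf (Opens.grothendieckTopology Z) (ModuleCat.{0} ℂ)) :
    (u.sheafPullback (ModuleCat.{0} ℂ) J (Opens.grothendieckTopology Z)).obj
      ((shriek u J).obj A) ⟶ A :=
  ((u.sheafAdjunctionContinuous (ModuleCat.{0} ℂ) J (Opens.grothendieckTopology Z)).homEquiv
    _ _).symm (shriekRes A)

theorem unit_comp_map_shriekCoreflection
    (A : Sheaf (Opens.grothendieckTopology Z) (ModuleCat.{0} ℂ)) :
    (u.sheafAdjunctionContinuous (ModuleCat.{0} ℂ) J (Opens.grothendieckTopology Z)).unit.app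
      ((shriek u J).obj A) ≫ (u.sheafPushforwardContinuous (ModuleCat.{0} ℂ) J
        (Opens.grothendieckTopology Z)).map (shriekCoreflection A) = shriekRes A := by
  refine (Adjunction.homEquiv_unit _ _ _ _).symm.trans ?_
  exact Equiv.apply_symm_apply _ _

theorem IsInnerBasis.shriekCoreflection_comp_unit (hu : IsInnerBasis u J)
    (A : Sheaf (Opens.grothendieckTopology Z) (ModuleCat.{0} ℂ)) :
    shriekCoreflection A ≫ hu.shriekAdjunction.unit.app A = 𝟙 _ := by
  let p := u.sheafAdjunctionContinuous (ModuleCat.{0} ℂ) J (Opens.grothendieckTopology Z)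
  apply (p.homEquiv _ _).injective
  rw [p.homEquiv_naturality_right, shriekCoreflection, Equiv.apply_symm_apply,
    hu.shriekAdjunction_unit, Functor.map_comp]
  refine Eq.trans ?_ (p.homEquiv_id _).symm
  have h := congrArg (· ≫ (u.sheafPushforwardContinuous (ModuleCat.{0} ℂ) J
    (Opens.grothendieckTopology Z)).map ((hu.innerAdjunction.leftAdjointUniq p).hom.app
      ((shriek u J).obj A))) (hu.shriekRes_comp_unit_inner A)
  refine (Category.assoc _ _ _).symm.trans (h.trans ?_)
  exact Adjunction.unit_leftAdjointUniq_hom_app _ _ _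

theorem IsInnerBasis.unit_comp_shriekCoreflection (hu : IsInnerBasis u J)
    (A : Sheaf (Opens.grothendieckTopology Z) (ModuleCat.{0} ℂ)) :
    hu.shriekAdjunction.unit.app A ≫ shriekCoreflection A = 𝟙 A := by
  let p := u.sheafAdjunctionContinuous (ModuleCat.{0} ℂ) J (Opens.grothendieckTopology Z)
  have e : (hu.innerAdjunction.leftAdjointUniq p).hom.app ((shriek u J).obj A) ≫
      shriekCoreflection A = hu.innerSheaf.map (shriekRes A) ≫ hu.innerIso.inv.app A := by
    rw [shriekCoreflection, Adjunction.homEquiv_counit, ← NatTrans.naturality_assoc]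
    congr 1
    exact Adjunction.leftAdjointUniq_hom_app_counit _ _ _
  rw [hu.shriekAdjunction_unit, Category.assoc]
  refine (congrArg _ e).trans ?_
  refine (Category.assoc _ _ _).symm.trans ?_
  exact (congrArg (· ≫ hu.innerIso.inv.app A) (hu.unit_comp_inner_map_shriekRes A)).trans
    (hu.innerIso.hom_inv_id_app A)

/-- The tensor statement is proved for coreflections because these transpose to `shriekRes`, which
is explicit on germs. After transposition and testing on `closureExt (A.obj ⊗ B.obj)`, it becomes
`closureExtTensor_res`. -/
theorem IsInnerBasis.map_shriekTensorIso_comp_pullbackTensor (hu : IsInnerBasis u J)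
    (A B : Sheaf (Opens.grothendieckTopology Z) (ModuleCat.{0} ℂ)) :
    (u.sheafPullback (ModuleCat.{0} ℂ) J (Opens.grothendieckTopology Z)).map
        (hu.shriekTensorIso.hom.app (A, B)) ≫
      pullbackTensor u J (Opens.grothendieckTopology Z) ((shriek u J).obj A)
        ((shriek u J).obj B) ≫ (shriekCoreflection A ⊗ₘ shriekCoreflection B) =
      shriekCoreflection (A ⊗ B) := by
  let p := u.sheafAdjunctionContinuous (ModuleCat.{0} ℂ) J (Opens.grothendieckTopology Z)
  let R := (Functor.whiskeringLeft _ _ (ModuleCat.{0} ℂ)).obj u.op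
  apply (p.homEquiv _ _).injective
  rw [p.homEquiv_naturality_left, p.homEquiv_naturality_right]
  refine Eq.trans ?_ (Equiv.apply_symm_apply (p.homEquiv _ _) (shriekRes (A ⊗ B))).symm
  apply hom_ext_of_W (hu.W_tensorToShriek A B)
  have h₁ : tensorToShriek A B ≫ (shriekRes (u := u) (J := J) (A ⊗ B)).hom =
      closureExtRes (u := u) (A.obj ⊗ B.obj) ≫ R.map (toSheafTensor _ A B) := by
    rw [tensorToShriek, Category.assoc, toShriek_shriekRes]
    exact closureExtRes_naturality _
  have e : ∀ A : Sheaf (Opens.grothendieckTopology Z) (ModuleCat.{0} ℂ),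
      𝟙 _ ≫ closureExtRes A.obj = (toShriek A ≫ (p.unit.app ((shriek u J).obj A)).hom) ≫
        R.map (shriekCoreflection (u := u) (J := J) A).hom := by
    intro A
    rw [Category.id_comp, ← toShriek_shriekRes (J := J), ← unit_comp_map_shriekCoreflection (J := J)]
    exact (Category.assoc _ _ _).symm
  have key : (toShriek A ⊗ₘ toShriek B) ≫
      (toSheafTensor J ((shriek u J).obj A) ((shriek u J).obj B) ≫ (p.homEquiv _ _ (pullbackTensor u J (Opens.grothendieckTopology Z)
        ((shriek u J).obj A) ((shriek u J).obj B))).hom) ≫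
          R.map (shriekCoreflection A ⊗ₘ shriekCoreflection B).hom =
      (closureExtRes A.obj ⊗ₘ closureExtRes B.obj) ≫ Functor.LaxMonoidal.μ R A.obj B.obj ≫
        R.map (toSheafTensor _ A B) := by
    have h := tensorHom_comp_μ_comp_map R (e A) (e B) (toSheafTensor_naturality _ _)
    rw [id_tensorHom_id, Category.id_comp] at h
    rw [toSheafTensor_homEquiv_pullbackTensor, h]
    exact tensorHom_comp_tensorHom_comp_three _ _ _ _ _ _ _
  refine Eq.trans ?_ h₁.symm
  refine (Category.assoc _ _ _).symm.trans ((congrArg (· ≫ (p.homEquiv _ _ (pullbackTensor u J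
    (Opens.grothendieckTopology Z) ((shriek u J).obj A) ((shriek u J).obj B)) ≫
      (u.sheafPushforwardContinuous (ModuleCat.{0} ℂ) J (Opens.grothendieckTopology Z)).map
        (shriekCoreflection A ⊗ₘ shriekCoreflection B)).hom)
          (hu.shriekTensorIso_hom A B)).trans ?_)
  refine (comp_assoc_five _ _ _ _ _).trans ((congrArg (closureExtTensor A.obj B.obj ≫ ·) key).trans ?_)
  rw [← closureExtTensor_res]
  simp only [Category.assoc]
  rfl

end Shriek

/-- This converts the identity for coreflections (`ε`, `c`) into the identity for units (`η`, `n`).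
-/
theorem comp_eq_of_comp_eq_id {C : Type*} [Category C] {W P Q R : C} {η : W ⟶ P} {m : P ⟶ Q}
    {p : Q ⟶ R} {c : R ⟶ W} {ε : P ⟶ W} {n : W ⟶ R} (h : m ≫ p ≫ c = ε) (hη : η ≫ ε = 𝟙 W)
    (hn : c ≫ n = 𝟙 R) : η ≫ m ≫ p = n := by
  calc η ≫ m ≫ p = η ≫ m ≫ p ≫ c ≫ n := by rw [hn, Category.comp_id]
    _ = (η ≫ ε) ≫ n := by simp [← h]
    _ = n := by rw [hη, Category.id_comp]

section Shriek

variable {Z C : Type} [TopologicalSpace Z] [Preorder C] {u : C ⥤ Opens Z}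
  {J : GrothendieckTopology C} [u.IsContinuous J (Opens.grothendieckTopology Z)]

theorem IsInnerBasis.unit_comp_map_shriekTensorIso (hu : IsInnerBasis u J)
    (A B : Sheaf (Opens.grothendieckTopology Z) (ModuleCat.{0} ℂ)) :
    hu.shriekAdjunction.unit.app (A ⊗ B) ≫
        (u.sheafPullback (ModuleCat.{0} ℂ) J (Opens.grothendieckTopology Z)).map
          (hu.shriekTensorIso.hom.app (A, B)) ≫
        pullbackTensor u J (Opens.grothendieckTopology Z) ((shriek u J).obj A)
          ((shriek u J).obj B) =
      hu.shriekAdjunction.unit.app A ⊗ₘ hu.shriekAdjunction.unit.app B := by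
  have h₁ : (shriekCoreflection A ⊗ₘ shriekCoreflection B) ≫
      (hu.shriekAdjunction.unit.app A ⊗ₘ hu.shriekAdjunction.unit.app B) = 𝟙 _ := by
    refine (tensorHom_comp_tensorHom _ _ _ _).trans ?_
    rw [hu.shriekCoreflection_comp_unit, hu.shriekCoreflection_comp_unit]
    exact id_tensorHom_id _ _
  exact comp_eq_of_comp_eq_id (hu.map_shriekTensorIso_comp_pullbackTensor A B)
    (hu.unit_comp_shriekCoreflection (A ⊗ B)) h₁

/-- The adjunction and the tensor isomorphism are both conjugated by `θ`; the copies of `θ` cancel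
in the unit identity by naturality of `pullbackTensor`. Right exactness holds because `T` is a left
adjoint. -/
theorem IsInnerBasis.exists_adjunction_of_iso (hu : IsInnerBasis u J)
    {T : Sheaf (Opens.grothendieckTopology Z) (ModuleCat.{0} ℂ) ⥤ Sheaf J (ModuleCat.{0} ℂ)}
    (θ : T ≅ shriek u J) :
    ∃ adj : T ⊣ u.sheafPullback (ModuleCat.{0} ℂ) J (Opens.grothendieckTopology Z),
      (PreservesFiniteLimits T ∧ PreservesFiniteColimits T) ∧
      ∃ e : tensor (Sheaf (Opens.grothendieckTopology Z) (ModuleCat.{0} ℂ)) ⋙ T ≅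
          T.prod T ⋙ tensor (Sheaf J (ModuleCat.{0} ℂ)),
        ∀ A B : Sheaf (Opens.grothendieckTopology Z) (ModuleCat.{0} ℂ),
          adj.unit.app (A ⊗ B) ≫
              (u.sheafPullback (ModuleCat.{0} ℂ) J (Opens.grothendieckTopology Z)).map
                (e.hom.app (A, B)) ≫
              pullbackTensor u J (Opens.grothendieckTopology Z) (T.obj A) (T.obj B) =
            adj.unit.app A ⊗ₘ adj.unit.app B := by
  let adj := hu.shriekAdjunction.ofNatIsoLeft θ.symm
  let P := u.sheafPullback (ModuleCat.{0} ℂ) J (Opens.grothendieckTopology Z)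
  have hadj : ∀ A, adj.unit.app A = hu.shriekAdjunction.unit.app A ≫ P.map (θ.inv.app A) := by
    intro A
    simp [adj, P, Adjunction.ofNatIsoLeft]
  refine ⟨adj, ⟨preservesFiniteLimits_of_natIso θ.symm, ?_⟩,
    Functor.isoWhiskerLeft _ θ ≪≫ hu.shriekTensorIso ≪≫
      Functor.isoWhiskerRight (NatIso.prod θ.symm θ.symm) _, fun A B => ?_⟩
  · have := adj.leftAdjoint_preservesColimits
    infer_instance
  · have h := hu.unit_comp_map_shriekTensorIso A B
    have hθ : P.map (θ.inv.app (A ⊗ B)) ≫ P.map (θ.hom.app (A ⊗ B)) = 𝟙 _ := by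
      rw [← P.map_comp, Iso.inv_hom_id_app, P.map_id]
    have hn := pullbackTensor_naturality u J (Opens.grothendieckTopology Z) (θ.inv.app A)
      (θ.inv.app B)
    rw [hadj, hadj, hadj, ← tensorHom_comp_tensorHom, ← h]
    simp only [Category.assoc]
    rw [← hn]
    congr 1
    change P.map _ ≫ P.map (θ.hom.app (A ⊗ B) ≫ hu.shriekTensorIso.hom.app (A, B) ≫
      (θ.inv.app A ⊗ₘ θ.inv.app B)) ≫ _ = _
    rw [P.map_comp, P.map_comp, Category.assoc, Category.assoc, reassoc_of% hθ]

end Shriek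

/-! ### Changing the site through a basis -/

section Comparison

variable {Z B C : Type} [TopologicalSpace Z] [Preorder B] [Preorder C] (v : B ⥤ C)
  (u : C ⥤ Opens Z) (JB : GrothendieckTopology B) (J : GrothendieckTopology C)
  [v.IsContinuous JB J] [u.IsContinuous J (Opens.grothendieckTopology Z)]
  [(v ⋙ u).IsContinuous JB (Opens.grothendieckTopology Z)]

/-- Inverse images compose; if the direct image along `v` is fully faithful, then the inverse image
along `u` is obtained by restricting along `v` and taking the inverse image along `v ⋙ u`. -/
def pullbackRestrictIso
    [(v.sheafPushforwardContinuous (ModuleCat.{0} ℂ) JB J).Full]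
    [(v.sheafPushforwardContinuous (ModuleCat.{0} ℂ) JB J).Faithful] :
    v.sheafPushforwardContinuous (ModuleCat.{0} ℂ) JB J ⋙
        (v ⋙ u).sheafPullback (ModuleCat.{0} ℂ) JB (Opens.grothendieckTopology Z) ≅
      u.sheafPullback (ModuleCat.{0} ℂ) J (Opens.grothendieckTopology Z) :=
  Functor.isoWhiskerLeft _
      (((v ⋙ u).sheafAdjunctionContinuous (ModuleCat.{0} ℂ) JB
        (Opens.grothendieckTopology Z)).leftAdjointUniq
        ((v.sheafAdjunctionContinuous (ModuleCat.{0} ℂ) JB J).comp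
          (u.sheafAdjunctionContinuous (ModuleCat.{0} ℂ) J (Opens.grothendieckTopology Z)))) ≪≫
    (Functor.associator _ _ _).symm ≪≫
    -- The counit is invertible because the right adjoint is fully faithful.
    Functor.isoWhiskerRight (asIso (v.sheafAdjunctionContinuous (ModuleCat.{0} ℂ) JB J).counit) _ ≪≫
    Functor.leftUnitor _

variable {v u JB J}

/-- The left adjoint of the inverse image along `u` obtained from that along `v ⋙ u`. -/
def IsInnerBasis.shriekPullbackAdjunction (h : IsInnerBasis (v ⋙ u) JB)
    [(v.sheafPushforwardContinuous (ModuleCat.{0} ℂ) JB J).Full]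
    [(v.sheafPushforwardContinuous (ModuleCat.{0} ℂ) JB J).Faithful] :
    shriek (v ⋙ u) JB ⋙ v.sheafPullback (ModuleCat.{0} ℂ) JB J ⊣
      u.sheafPullback (ModuleCat.{0} ℂ) J (Opens.grothendieckTopology Z) :=
  (h.shriekAdjunction.comp (v.sheafAdjunctionContinuous (ModuleCat.{0} ℂ) JB J)).ofNatIsoRight
    (pullbackRestrictIso v u JB J)

/-- If the direct image along `v` is an equivalence, then it is inverse to the inverse image. -/
def pullbackPushforwardIso (v : B ⥤ C) (JB : GrothendieckTopology B) (J : GrothendieckTopology C)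
    [v.IsContinuous JB J] [(v.sheafPushforwardContinuous (ModuleCat.{0} ℂ) JB J).IsEquivalence] :
    v.sheafPullback (ModuleCat.{0} ℂ) JB J ⋙
      v.sheafPushforwardContinuous (ModuleCat.{0} ℂ) JB J ≅ 𝟭 _ :=
  have := (v.sheafAdjunctionContinuous (ModuleCat.{0} ℂ) JB J).isEquivalence_left_of_isEquivalence_right
  (asIso (v.sheafAdjunctionContinuous (ModuleCat.{0} ℂ) JB J).unit).symm

end Comparison

/-! ### Small relatively compact subanalytic neighbourhoods -/

section Geometry

variable {E : Type} [NormedAddCommGroup E] [NormedSpace ℝ E] {X : Type} [TopologicalSpace X]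
  [ChartedSpace E X]

/-- A relatively compact semianalytic set is subanalytic. -/
theorem IsSemianalytic.isSubanalytic [T2Space X] {A : Set X} (hA : IsSemianalytic 𝓘(ℝ, E) A)
    (hc : IsCompact (closure A)) : IsSubanalytic 𝓘(ℝ, E) A := by
  intro x
  -- A zero-dimensional parameter space makes the projection a bijection, so no actual projecting
  -- takes place.
  refine ⟨Set.univ, isOpen_univ, trivial, EuclideanSpace ℝ (Fin 0), inferInstance, inferInstance,
    inferInstance, Prod.fst ⁻¹' A, hA.preimage contMDiff_fst, ?_, ?_⟩
  · refine (hc.prod (isCompact_univ (X := EuclideanSpace ℝ (Fin 0)))).closure_of_subset ?_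
    exact fun z hz => ⟨subset_closure hz, trivial⟩
  · rw [Set.inter_univ, Set.image_preimage_eq _ Prod.fst_surjective]

variable [T2Space X] [FiniteDimensional ℝ E] [IsManifold 𝓘(ℝ, E) ω X]

omit [T2Space X] in
theorem contMDiffOn_sub_norm_sq_chart (x : X) (r : ℝ) :
    ContMDiffOn 𝓘(ℝ, E) 𝓘(ℝ, ℝ) ω
      (fun z => r - ‖toEuclidean (chartAt E x z) - toEuclidean (chartAt E x x)‖ ^ 2)
      (chartAt E x).source := by
  have h : ContDiff ℝ ω fun v : E =>
      r - ‖toEuclidean v - toEuclidean (chartAt E x x)‖ ^ 2 :=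
    contDiff_const.sub ((toEuclidean.contDiff.sub contDiff_const).norm_sq ℝ)
  exact h.contMDiff.comp_contMDiffOn contMDiffOn_chart

omit [T2Space X] [IsManifold 𝓘(ℝ, E) ω X] [TopologicalSpace X] [ChartedSpace E X] in
theorem mem_euclidean_ball_iff {v w : E} {r : ℝ} (hr : 0 < r) :
    v ∈ Euclidean.ball w r ↔ 0 < r ^ 2 - ‖toEuclidean v - toEuclidean w‖ ^ 2 := by
  rw [sub_pos, sq_lt_sq₀ (norm_nonneg _) hr.le, ← dist_eq_norm]
  exact Iff.rfl

omit [T2Space X] [ChartedSpace E X] [IsManifold 𝓘(ℝ, E) ω X] in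
theorem exists_euclidean_closedBall_subset (φ : OpenPartialHomeomorph X E) {x : X} {N : Set X}
    (hN : IsOpen N) (hxN : x ∈ N) (hx : x ∈ φ.source) :
    ∃ r : ℝ, 0 < r ∧ Euclidean.closedBall (φ x) r ⊆ φ.target ∩ φ.symm ⁻¹' N := by
  refine Euclidean.nhds_basis_closedBall.mem_iff.1 ?_
  exact Filter.inter_mem (φ.open_target.mem_nhds (φ.map_source hx))
    ((φ.continuousAt_symm (φ.map_source hx)).preimage_mem_nhds
      (by rw [φ.left_inv hx]; exact hN.mem_nhds hxN))

omit [T2Space X] [IsManifold 𝓘(ℝ, E) ω X] [ChartedSpace E X] in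
theorem source_inter_preimage_ball_subset (φ : OpenPartialHomeomorph X E) (v : E) (r : ℝ) :
    φ.source ∩ φ ⁻¹' Euclidean.ball v r ⊆ φ.symm '' Euclidean.closedBall v r :=
  fun y hy => ⟨φ y, Euclidean.ball_subset_closedBall hy.2, φ.left_inv hy.1⟩

/-- Inside the chart domain a single strict inequality on a squared Euclidean norm, which is
analytic, cuts out the set. Away from the domain the set is locally empty, since it lies in a
compact part of the domain. -/
theorem isSemianalytic_chart_preimage_ball (x : X) {r : ℝ} (hr : 0 < r)
    (h : Euclidean.closedBall (chartAt E x x) r ⊆ (chartAt E x).target) :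
    IsSemianalytic 𝓘(ℝ, E)
      ((chartAt E x).source ∩ chartAt E x ⁻¹' Euclidean.ball (chartAt E x x) r) := by
  intro y
  by_cases hy : y ∈ (chartAt E x).source
  · refine ⟨(chartAt E x).source, (chartAt E x).open_source, hy, Unit, Unit, inferInstance,
      inferInstance, fun _ _ _ => 0,
      fun _ _ z => r ^ 2 - ‖toEuclidean (chartAt E x z) - toEuclidean (chartAt E x x)‖ ^ 2,
      fun _ _ => ⟨contMDiffOn_const, contMDiffOn_sub_norm_sq_chart x _⟩, ?_⟩
    ext z
    have h := mem_euclidean_ball_iff (v := chartAt E x z) (w := chartAt E x x) hr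
    exact ⟨fun hz => ⟨hz.2, (), fun _ => ⟨rfl, h.1 hz.1.2⟩⟩,
      fun ⟨hz, _, hz'⟩ => ⟨⟨hz, h.2 (hz' ()).2⟩, hz⟩⟩
  · have hK : IsCompact ((chartAt E x).symm '' Euclidean.closedBall (chartAt E x x) r) :=
      Euclidean.isCompact_closedBall.image_of_continuousOn ((chartAt E x).continuousOn_symm.mono h)
    -- On the complement of the compact image of the closed ball the set is empty, hence a union
    -- over an empty index type.
    refine ⟨_, hK.isClosed.isOpen_compl, ?_, Empty, Empty, inferInstance,
      inferInstance, fun i => i.elim, fun i => i.elim, fun i => i.elim, ?_⟩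
    · rintro ⟨w, hw, rfl⟩
      exact hy ((chartAt E x).map_target (h hw))
    · ext z
      simp only [Set.mem_inter_iff, IsEmpty.exists_iff, and_false, Set.mem_ofPred_eq, iff_false]
      exact fun hz => hz.2 (source_inter_preimage_ball_subset _ _ _ hz.1)

variable (E) in
/-- The points of a manifold have arbitrarily small relatively compact subanalytic open
neighbourhoods. -/
theorem exists_isSaOpen_closure_subset {x : X} {N : Set X} (hN : IsOpen N) (hx : x ∈ N) :
    ∃ U : Set X, IsSaOpen E U ∧ IsCompact (closure U) ∧ x ∈ U ∧ closure U ⊆ N := by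
  have hxs : x ∈ (chartAt E x).source := mem_chart_source E x
  obtain ⟨r, hr, hsub⟩ := exists_euclidean_closedBall_subset (chartAt E x) hN hx hxs
  have hK : IsCompact ((chartAt E x).symm '' Euclidean.closedBall (chartAt E x x) r) :=
    Euclidean.isCompact_closedBall.image_of_continuousOn
      ((chartAt E x).continuousOn_symm.mono fun y hy => (hsub hy).1)
  have hcl := closure_minimal (source_inter_preimage_ball_subset (chartAt E x) (chartAt E x x) r)
    hK.isClosed
  have hc := hK.of_isClosed_subset isClosed_closure hcl
  have hU := isSemianalytic_chart_preimage_ball x hr fun y hy => (hsub hy).1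
  refine ⟨_, ⟨?_, hU.isSubanalytic hc⟩, hc, ⟨hxs, ?_⟩, hcl.trans ?_⟩
  · exact (chartAt E x).continuousOn.isOpen_inter_preimage (chartAt E x).open_source
      Euclidean.isOpen_ball
  · exact Set.mem_preimage.2 (Euclidean.mem_ball_self hr)
  · rintro _ ⟨y, hy, rfl⟩
    exact (hsub hy).2

variable {F S : Type} [NormedAddCommGroup F] [NormedSpace ℝ F] [TopologicalSpace S]
  [ChartedSpace F S] [T2Space S] [FiniteDimensional ℝ F] [IsManifold 𝓘(ℝ, F) ω S]

variable (E F) in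
theorem exists_isBox_closure_subset {z : X × S} {W : Set (X × S)} (hW : IsOpen W) (hz : z ∈ W) :
    ∃ R, IsBox E F R ∧ z ∈ R ∧ closure R ⊆ W := by
  obtain ⟨N, N', hN, hN', hzN, hzN', hsub⟩ := isOpen_prod_iff.1 hW z.1 z.2 hz
  obtain ⟨U, hU, hUc, hzU, hUN⟩ := exists_isSaOpen_closure_subset E hN hzN
  obtain ⟨V, hV, hVc, hzV, hVN⟩ := exists_isSaOpen_closure_subset F hN' hzN'
  refine ⟨U ×ˢ V, ⟨U, V, ⟨hU, hUc⟩, ⟨hV, hVc⟩, rfl⟩, ⟨hzU, hzV⟩, ?_⟩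
  rw [closure_prod_eq]
  exact (Set.prod_mono hUN hVN).trans hsub

end Geometry

/-! ### Boxes form an inner basis -/

section Sites

variable (E F X S : Type) [NormedAddCommGroup E] [NormedSpace ℝ E] [FiniteDimensional ℝ E]
  [NormedAddCommGroup F] [NormedSpace ℝ F] [FiniteDimensional ℝ F]
  [TopologicalSpace X] [T2Space X] [ChartedSpace E X] [IsManifold 𝓘(ℝ, E) ω X]
  [TopologicalSpace S] [T2Space S] [ChartedSpace F S] [IsManifold 𝓘(ℝ, F) ω S]

/-- The inclusion of the products of relatively compact subanalytic open subsets in the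
open subsets. -/
abbrev boxToOpens : Box E F X S ⥤ Opens (X × S) := boxToBiSa E F X S ⋙ biSaToOpens E F X S

omit [FiniteDimensional ℝ E] [FiniteDimensional ℝ F] [IsManifold 𝓘(ℝ, E) ω X]
  [IsManifold 𝓘(ℝ, F) ω S] in
instance : (boxToOpens E F X S).IsContinuous (boxTopology E F X S)
    (Opens.grothendieckTopology (X × S)) :=
  Functor.isContinuous_comp _ _ _ (biSaTopology E F X S) _

/-- Coverings of boxes must have finite subcovers. These exist because the closure of a box, not
merely the box, is covered, and that closure is compact. -/
theorem isInnerBasis_boxToOpens :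
    IsInnerBasis (boxToOpens E F X S) (boxTopology E F X S) where
  le_of_obj_le h := h
  exists_mem {W z} hz := by
    obtain ⟨R, hR, hzR, hRW⟩ := exists_isBox_closure_subset E F W.isOpen hz
    exact ⟨⟨⟨R, hR.isOpen⟩, hR⟩, hzR, hRW⟩
  exists_cover R 𝒲 h𝒲 := by
    have key : ∀ z ∈ closure (R.1 : Set (X × S)), ∃ Q : Box E F X S, z ∈ Q.1 ∧
        ∃ W ∈ 𝒲, closure (Q.1 : Set (X × S)) ⊆ W := by
      intro z hz
      obtain ⟨W, hW, hzW⟩ := h𝒲 z hz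
      obtain ⟨Q, hQ, hzQ, hQW⟩ := exists_isBox_closure_subset E F W.isOpen hzW
      exact ⟨⟨⟨Q, hQ.isOpen⟩, hQ⟩, hzQ, W, hW, hQW⟩
    have : Nonempty (Box E F X S) := ⟨R⟩
    choose! Q hzQ hQ using key
    obtain ⟨t, ht, hcov⟩ := R.2.isCompact_closure.elim_nhds_subcover (fun z => (Q z).1)
      fun z hz => (Q z).1.isOpen.mem_nhds (hzQ z hz)
    refine ⟨{ arrows := fun P _ => ∃ W ∈ 𝒲, closure (P.1 : Set (X × S)) ⊆ W
              downward_closed := ?_ }, ?_, fun d f hf => hf⟩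
    · rintro P P' _ ⟨W, hW, hPW⟩ g
      exact ⟨W, hW, (closure_mono (leOfHom g)).trans hPW⟩
    · refine ⟨(fun z => ⟨(Q z).1 ⊓ R.1, (Q z).2.inter R.2⟩) '' (t : Set (X × S)),
        t.finite_toSet.image _, ?_, ?_⟩
      · rintro _ ⟨z, hz, rfl⟩
        obtain ⟨W, hW, hQW⟩ := hQ z (ht z hz)
        exact ⟨homOfLE (inf_le_right : (Q z).1 ⊓ R.1 ≤ R.1), W, hW,
          (closure_mono Set.inter_subset_left).trans hQW⟩
      · intro y hy
        obtain ⟨z, hz, hyz⟩ := Set.mem_iUnion₂.1 (hcov (subset_closure hy))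
        exact Set.mem_iUnion₂.2 ⟨_, ⟨z, hz, rfl⟩, hyz, hy⟩

end Sites

/-! ### Continuous functors and covering sieves -/

section Continuous

variable {C D : Type} [SmallCategory C] [SmallCategory D]

/-- Continuous functors preserve covering sieves, because closed sieves form a sheaf. -/
theorem functorPushforward_mem_of_isContinuous (G : C ⥤ D) (J : GrothendieckTopology C)
    (K : GrothendieckTopology D) [G.IsContinuous J K] {R : C} {T : Sieve R} (hT : T ∈ J R) :
    T.functorPushforward G ∈ K (G.obj R) := by
  have hs := G.op_comp_isSheaf_of_isSheaf_type (J := J) (classifier_isSheaf K)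
  -- In the sheaf of closed sieves, the closure of the pushforward and the maximal sieve agree on
  -- every arrow of `T`, so they are equal.
  have h := (hs T hT).isSeparatedFor.ext
    (t₁ := ⟨K.close (T.functorPushforward G), K.close_isClosed _⟩)
    (t₂ := ⟨(⊤ : Sieve (G.obj R)), fun _ _ _ => trivial⟩) fun Q f hf => ?_
  · exact (K.close_eq_top_iff_mem _).1 (congrArg Subtype.val h)
  · refine Subtype.ext ?_
    change (K.close (T.functorPushforward G)).pullback (G.map f) = (⊤ : Sieve _).pullback (G.map f)
    rw [Sieve.pullback_top, ← Sieve.mem_iff_pullback_eq_top]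
    exact K.le_close _ _ (Sieve.image_mem_functorPushforward G T hf)

end Continuous

/-! ### Density of boxes in the two subanalytic sites -/

section Sites

variable (E F X S : Type) [NormedAddCommGroup E] [NormedSpace ℝ E] [NormedAddCommGroup F]
  [NormedSpace ℝ F] [TopologicalSpace X] [T2Space X] [ChartedSpace E X]
  [TopologicalSpace S] [T2Space S] [ChartedSpace F S]

instance : (boxToBiSa E F X S).Full := ⟨fun f => ⟨homOfLE (leOfHom f), rfl⟩⟩

instance : (boxToRel E F X S).Full := ⟨fun f => ⟨homOfLE (leOfHom f), rfl⟩⟩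

instance : (boxToBiSa E F X S).IsCoverDense (biSaTopology E F X S) :=
  ⟨fun _ R hR => ⟨{(boxToBiSa E F X S).obj R}, Set.finite_singleton _, by
    rintro _ rfl
    exact ⟨homOfLE hR, Presieve.in_coverByImage _ _⟩, by
      rw [Set.biUnion_singleton]
      exact subset_rfl⟩⟩

instance : (boxToBiSa E F X S).IsDenseSubsite (boxTopology E F X S) (biSaTopology E F X S) where
  functorPushforward_mem_iff {R T} := by
    refine ⟨fun hT => ?_, functorPushforward_mem_of_isContinuous _ _ _⟩
    -- The covering condition is tested on the box `R` itself. Each member of the finite subcover is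
    -- then enlarged to the box of `T` through which it factors.
    obtain ⟨Φ, hΦ, hΦT, hcov⟩ := hT R le_rfl
    have key : ∀ W' : Φ, ∃ Q : Box E F X S, (∃ f : Q ⟶ R, T f) ∧ W'.1.1 ≤ Q.1 := by
      rintro ⟨W', hW'⟩
      obtain ⟨_, Q, g, h, hg, -⟩ := hΦT W' hW'
      exact ⟨Q, ⟨g, hg⟩, leOfHom h⟩
    choose Q hQ hle using key
    have := hΦ.to_subtype
    refine ⟨Set.range Q, Set.finite_range Q, ?_, ?_⟩
    · rintro _ ⟨W', rfl⟩
      exact hQ W'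
    · intro y hy
      obtain ⟨W', hW', hyW'⟩ := Set.mem_iUnion₂.1 (hcov hy)
      exact Set.mem_iUnion₂.2 ⟨_, ⟨⟨W', hW'⟩, rfl⟩, hle ⟨W', hW'⟩ hyW'⟩

variable [FiniteDimensional ℝ E] [FiniteDimensional ℝ F] [IsManifold 𝓘(ℝ, E) ω X]
  [IsManifold 𝓘(ℝ, F) ω S]

variable {X} in
/-- The relatively compact subanalytic open subsets of `U` form a covering of `U`. -/
theorem isSaCover_relativelyCompact {U : Set X} (hU : IsSaOpen E U) :
    IsSaCover E U {U' | (IsSaOpen E U' ∧ IsCompact (closure U')) ∧ U' ⊆ U} := by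
  refine ⟨fun U' h => ⟨h.1.1, h.2⟩, fun K hK => ?_⟩
  choose B hB hBc hxB _ using fun x : X => exists_isSaOpen_closure_subset E isOpen_univ
    (Set.mem_univ x)
  obtain ⟨t, -, hcov⟩ := hK.elim_nhds_subcover B fun x _ => (hB x).1.mem_nhds (hxB x)
  refine ⟨(fun x => U ∩ B x) '' t, ?_, t.finite_toSet.image _, ?_⟩
  · rintro _ ⟨x, -, rfl⟩
    exact ⟨⟨hU.inter (hB x), (hBc x).of_isClosed_subset isClosed_closure
      (closure_mono Set.inter_subset_right)⟩, Set.inter_subset_left⟩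
  · ext y
    refine and_congr_right fun hy => ⟨?_, fun hyU => ?_⟩
    · rintro ⟨_, ⟨x, -, rfl⟩, hy⟩
      exact hy.1
    · obtain ⟨x, hx, hyx⟩ := Set.mem_iUnion₂.1 (hcov hy)
      exact ⟨_, ⟨x, hx, rfl⟩, hyU, hyx⟩

/-- In a product `U × V`, relatively compact subanalytic pieces cover `U` in `X_sa` and cover `V` in
the usual topology, and products of such pieces are boxes. With fullness this makes restriction of
sheaves to boxes fully faithful. -/
instance : (boxToRel E F X S).IsCoverDense (relTopology E X S) where
  is_cover W := by
    have h : IsRelCover X W (Sieve.coverByImage (boxToRel E F X S) W).arrows := by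
      intro U V hU hV hUV
      refine ⟨_, {V' | (IsSaOpen F V' ∧ IsCompact (closure V')) ∧ V' ⊆ V},
        isSaCover_relativelyCompact E hU, ⟨fun V' h => h.1.1.1, ?_⟩, ?_⟩
      · refine subset_antisymm (Set.sUnion_subset fun V' h => h.2) fun s hs => ?_
        obtain ⟨V', hV', hc, hsV', hsub⟩ := exists_isSaOpen_closure_subset F hV hs
        exact ⟨V', ⟨⟨hV', hc⟩, subset_closure.trans hsub⟩, hsV'⟩
      · rintro U' ⟨hU', hUU'⟩ V' ⟨hV', hVV'⟩
        let R : Box E F X S := ⟨⟨U' ×ˢ V', hU'.1.1.prod hV'.1.1⟩, U', V', hU', hV', rfl⟩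
        exact ⟨(boxToRel E F X S).obj R, homOfLE ((Set.prod_mono hUU' hVV').trans hUV),
          Presieve.in_coverByImage _ _, subset_rfl⟩
    have := Coverage.Saturate.of (K := relCoverage E X S) _ _ h
    rwa [Sieve.generate_sieve] at this

variable {E F X S} in
-- An object of `X_sa × S` need not be relatively compact, so compactness does not apply directly.
-- It is covered by boxes, and the refinements found for boxes remain coverings in `X_sa × S` by
-- continuity.
theorem isInnerBasis_relToOpens (hB : IsInnerBasis (boxToOpens E F X S) (boxTopology E F X S)) :
    IsInnerBasis (relToOpens E X S) (relTopology E X S) where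
  le_of_obj_le h := h
  exists_mem {W z} hz := by
    obtain ⟨R, hR⟩ := hB.exists_mem hz
    exact ⟨(boxToRel E F X S).obj R, hR⟩
  exists_cover W 𝒲 h𝒲 := by
    let T : Sieve W :=
      { arrows := fun P _ => ∃ W ∈ 𝒲, closure (P.1 : Set (X × S)) ⊆ W
        downward_closed := by
          rintro P P' _ ⟨W, hW, hPW⟩ g
          exact ⟨W, hW, (closure_mono (leOfHom g)).trans hPW⟩ }
    refine ⟨T, ?_, fun d f hf => hf⟩
    refine (relTopology E X S).transitive
      ((boxToRel E F X S).is_cover_of_isCoverDense (relTopology E X S) W) _ ?_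
    rintro P _ ⟨⟨R, f, g, rfl⟩⟩
    rw [Sieve.pullback_comp]
    refine (relTopology E X S).pullback_stable f ?_
    obtain ⟨T', hT', h⟩ := hB.exists_cover R 𝒲 fun z hz =>
      h𝒲 z (closure_mono (leOfHom g) hz)
    refine (relTopology E X S).superset_covering ?_
      (functorPushforward_mem_of_isContinuous (boxToRel E F X S) (boxTopology E F X S) _ hT')
    rintro Q _ ⟨R', i, j, hi, rfl⟩
    obtain ⟨W', hW', hsub⟩ := h R' i hi
    exact ⟨W', hW', (closure_mono (leOfHom j)).trans hsub⟩

end Sites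

end RelSubanalytic

end

theorem mainTheorem7
    (E F X S : Type)
    [NormedAddCommGroup E] [NormedSpace ℝ E] [FiniteDimensional ℝ E]
    [NormedAddCommGroup F] [NormedSpace ℝ F] [FiniteDimensional ℝ F]
    [TopologicalSpace X] [T2Space X] [SecondCountableTopology X]
    [ChartedSpace E X] [IsManifold 𝓘(ℝ, E) ω X]
    [TopologicalSpace S] [T2Space S] [SecondCountableTopology S]
    [ChartedSpace F S] [IsManifold 𝓘(ℝ, F) ω S] :
    ∃ (rhoPrimeShriek : ModTop X S ⥤ ModBiSa E F X S)
      (_ : rhoPrimeShriek ⊣ rhoPrimeInv E F X S)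
      (rhoSShriek : ModTop X S ⥤ ModRel E X S)
      (_ : rhoSShriek = rhoPrimeShriek ⋙ aInv E F X S)
      (adj : rhoSShriek ⊣ rhoSInv E X S),
      (Limits.PreservesFiniteLimits rhoSShriek ∧ Limits.PreservesFiniteColimits rhoSShriek) ∧
      ∃ e : tensor (ModTop X S) ⋙ rhoSShriek ≅
          rhoSShriek.prod rhoSShriek ⋙ tensor (ModRel E X S),
        ∀ A B : ModTop X S,
          adj.unit.app (A ⊗ B) ≫ (rhoSInv E X S).map (e.hom.app (A, B)) ≫
              pullbackTensor (relToOpens E X S) (relTopology E X S)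
                (Opens.grothendieckTopology (X × S)) (rhoSShriek.obj A) (rhoSShriek.obj B) =
            adj.unit.app A ⊗ₘ adj.unit.app B := by
  have hB := isInnerBasis_boxToOpens E F X S
  have hR := isInnerBasis_relToOpens hB
  -- Both routes from boxes to open sets, through `X_sa × S_sa` or `X_sa × S`, are definitionally
  -- the same functor.
  have hB' : IsInnerBasis (boxToRel E F X S ⋙ relToOpens E X S) (boxTopology E F X S) := hB
  have : (boxToRel E F X S ⋙ relToOpens E X S).IsContinuous (boxTopology E F X S)
      (Opens.grothendieckTopology (X × S)) :=
    inferInstanceAs ((boxToOpens E F X S).IsContinuous _ _)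
  let adj := hB.shriekPullbackAdjunction (J := biSaTopology E F X S)
  -- Inverse image from boxes to `X_sa × S_sa` followed by restriction to boxes cancels by density.
  -- The remaining composite and `shriek` for `X_sa × S` are both left adjoint to `ρ_S⁻¹`.
  let θ : (shriek (boxToOpens E F X S) (boxTopology E F X S) ⋙
        (boxToBiSa E F X S).sheafPullback (ModuleCat.{0} ℂ) (boxTopology E F X S)
          (biSaTopology E F X S)) ⋙ aInv E F X S ≅
      shriek (relToOpens E X S) (relTopology E X S) :=
    Functor.isoWhiskerLeft (shriek (boxToOpens E F X S) (boxTopology E F X S))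
      (Functor.isoWhiskerRight (pullbackPushforwardIso (boxToBiSa E F X S) (boxTopology E F X S)
        (biSaTopology E F X S)) ((boxToRel E F X S).sheafPullback (ModuleCat.{0} ℂ)
          (boxTopology E F X S) (relTopology E X S))) ≪≫
      hB'.shriekPullbackAdjunction.leftAdjointUniq hR.shriekAdjunction
  obtain ⟨adjS, hexact, e, he⟩ := hR.exists_adjunction_of_iso θ
  exact ⟨_, adj, _, rfl, adjS, hexact, e, he⟩
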